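/- Let $(X_t)_{t\in\mathbb Z}$ be a strictly stationary real-valued time series, let $F_b$ be the law of $(X_1,\dots,X_b)'$ and $F_\infty$ the law of the whole series. Let $q\ge 1$, let $\theta=T_\infty(F_\infty)\in\mathbb R^q$ be the quantity of interest, and for $t\ge1$ let $\hat\theta_t\in\mathbb R^q$ be an estimator based on $(X_1,\dots,X_t)$, namely a functional of the point mass at $(X_1,\dots,X_t)'$. Let $(B_n)_{n\ge1}$ be positive integers (fixed or varying with $n$), and let $\bar\theta_n\in\mathbb R^q$ be functionals of $F_{B_n}$ (possibly depending on $n$) with $|\theta-\bar\theta_n|=o(n^{-1/2})$. Put $Y_{tn}=(X_{t-B_n+1},\dots,X_t)'$ and let $\rho_{B_n}^{t}=t^{-1}\sum_{s=1}^t\delta_{Y_{sn}}$ be the empirical distribution of $Y_{1n},\dots,Y_{tn}$. For each $b$ let $T_b$ be an $\mathbb R^q$-valued functional of $b$-dimensional distributions, with influence function $IF(y;F_{B_n})=\lim_{\epsilon\downarrow0}[T_{B_n}\{(1-\epsilon)F_{B_n}+\epsilon\delta_y\}-T_{B_n}(F_{B_n})]/\epsilon$, the limit existing for $F_{B_n}$-almost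 every $y$. Define the remainders $R_{tn}$ by $$T_{B_n}(\rho_{B_n}^{t})-\bar\theta_n=t^{-1}\sum_{s=1}^{t}IF(Y_{sn};F_{B_n})+R_{tn},\qquad 1\le t\le n .$$ Assume that $E\{IF(Y_{tn};F_{B_n})\}=0$ for $1\le t\le n$, and that $$n^{-1/2}\sum_{t=1}^{\lfloor rn\rfloor}IF(Y_{tn};F_{B_n})\Rightarrow\Delta B_q(r)$$ weakly in the space $D[0,1]$ of $\mathbb R^q$-valued càdlàg functions with the Skorokhod topology, where $B_q$ is a vector of $q$ independent standard Brownian motions and $\Delta$ is a lower triangular $q\times q$ matrix with $\Delta\Delta'$ positive definite. Suppose further that, with $|\cdot|$ the Euclidean norm, (i) $R_{nn}=o_p(n^{-1/2})$ and $n^{-2}\sum_{t=1}^n|tR_{tn}|^2=o_p(1)$; (ii) $T_{B_n}(\rho_{B_n}^n)-\hat\theta_n=o_p(n^{-1/2})$ and $n^{-2}\sum_{t=1}^n|t\{T_{B_n}(\rho_{B_n}^t)-\hat\theta_t\}|^2=o_p(1)$. Let $W_n=n^{-2}\sum_{t=1}^n t^2(\hat\theta_t-\hat\theta_n)(\hat\theta_t-\hat\theta_n)'$,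 $V_q=\int_0^1\{B_q(r)-rB_q(1)\}\{B_q(r)-rB_q(1)\}'\,dr$ and $U_q=B_q(1)'V_q^{-1}B_q(1)$. Then $V_q$ is almost surely invertible, $W_n$ is invertible with probability tending to $1$, and $$n(\hat\theta_n-\theta)'W_n^{-1}(\hat\theta_n-\theta)\rightarrow_D U_q$$ (the value of the statistic where $W_n$ is singular being immaterial). Consequently, for every $\alpha\in(0,1)$, with $U_{q,\alpha}$ the $100(1-\alpha)$th percentile of the distribution of $U_q$, the confidence region $\{\vartheta\in\mathbb R^q: n(\hat\theta_n-\vartheta)'W_n^{-1}(\hat\theta_n-\vartheta)\le U_{q,\alpha}\}$ contains $\theta$ with probability tending to $1-\alpha$. -/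

import Mathlib

open MeasureTheory ProbabilityTheory Filter
open scoped Topology ENNReal NNReal Matrix

noncomputable section

namespace SelfNorm

/-! ### The Skorokhod space `D([0,1]; E)` -/

/-- A function on `[0,1]` is càdlàg: right continuous with left limits.
At `t = 0` the left-limit clause is void, since `𝓝[<] 0 = ⊥` in `[0,1]`. -/
def IsCadlag {E : Type*} [TopologicalSpace E] (f : unitInterval → E) : Prop :=
  ∀ t : unitInterval,
    ContinuousWithinAt f (Set.Ici t) t ∧ ∃ l : E, Tendsto f (𝓝[<] t) (𝓝 l)

/-- The space `D([0,1]; E)` of càdlàg functions. -/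
structure SkorokhodSpace (E : Type*) [TopologicalSpace E] where
  /-- the underlying function -/
  toFun : unitInterval → E
  /-- it is càdlàg -/
  isCadlag : IsCadlag toFun

instance {E : Type*} [TopologicalSpace E] :
    CoeFun (SkorokhodSpace E) (fun _ => unitInterval → E) := ⟨SkorokhodSpace.toFun⟩

/-- The cost of a time change `l` (an increasing bijection of `[0,1]`):
`max (sup_t |l t - t|) (sup_t |x t - y (l t)|)`. -/
def skorokhodCost {E : Type*} [PseudoEMetricSpace E] (x y : SkorokhodSpace E)
    (l : unitInterval ≃o unitInterval) : ℝ≥0∞ :=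
  max (⨆ t, edist (l t) t) (⨆ t, edist (x t) (y (l t)))

theorem skorokhodCost_symm {E : Type*} [PseudoEMetricSpace E] (x y : SkorokhodSpace E)
    (l : unitInterval ≃o unitInterval) :
    skorokhodCost y x l.symm = skorokhodCost x y l := by
  unfold skorokhodCost
  congr 1
  · rw [← l.surjective.iSup_comp (g := fun t => edist (l.symm t) t)]
    simp [edist_comm]
  · rw [← l.surjective.iSup_comp (g := fun t => edist (y t) (x (l.symm t)))]
    simp [edist_comm]

theorem skorokhodCost_trans {E : Type*} [PseudoEMetricSpace E] (x y z : SkorokhodSpace E)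
    (l l' : unitInterval ≃o unitInterval) :
    skorokhodCost x z (l.trans l') ≤ skorokhodCost x y l + skorokhodCost y z l' := by
  unfold skorokhodCost
  refine max_le (iSup_le fun t => ?_) (iSup_le fun t => ?_)
  · calc edist ((l.trans l') t) t ≤ edist (l t) t + edist (l' (l t)) (l t) := by
          rw [add_comm]; exact edist_triangle _ _ _
      _ ≤ _ := add_le_add
          (le_max_of_le_left (le_iSup (fun t => edist (l t) t) t))
          (le_max_of_le_left (le_iSup (fun t => edist (l' t) t) (l t)))
  · calc edist (x t) (z ((l.trans l') t))
          ≤ edist (x t) (y (l t)) + edist (y (l t)) (z (l' (l t))) := edist_triangle _ _ _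
      _ ≤ _ := add_le_add
          (le_max_of_le_right (le_iSup (fun t => edist (x t) (y (l t))) t))
          (le_max_of_le_right (le_iSup (fun t => edist (y t) (z (l' t))) (l t)))

/-- Skorokhod's (J1) distance
`d(x,y) = inf_l max (sup_t |l t - t|) (sup_t |x t - y (l t)|)`, which induces the Skorokhod
topology. -/
instance {E : Type*} [PseudoEMetricSpace E] : PseudoEMetricSpace (SkorokhodSpace E) where
  edist x y := ⨅ l : unitInterval ≃o unitInterval, skorokhodCost x y l
  edist_self x := by
    refine le_antisymm (iInf_le_of_le (OrderIso.refl _) ?_) bot_le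
    simp [skorokhodCost]
  edist_comm x y := by
    refine le_antisymm (le_iInf fun l => ?_) (le_iInf fun l => ?_)
    · exact iInf_le_of_le l.symm (skorokhodCost_symm y x l).le
    · exact iInf_le_of_le l.symm (skorokhodCost_symm x y l).le
  edist_triangle x y z := by
    rw [ENNReal.iInf_add]
    refine le_iInf fun l => ?_
    rw [ENNReal.add_iInf]
    refine le_iInf fun l' => ?_
    exact iInf_le_of_le (l.trans l') (skorokhodCost_trans x y z l l')

instance {E : Type*} [PseudoEMetricSpace E] : MeasurableSpace (SkorokhodSpace E) := borel _

instance {E : Type*} [PseudoEMetricSpace E] : BorelSpace (SkorokhodSpace E) := ⟨rfl⟩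

theorem Continuous.isCadlag {E : Type*} [TopologicalSpace E] {f : unitInterval → E}
    (hf : Continuous f) : IsCadlag f := fun t =>
  ⟨hf.continuousWithinAt, f t, hf.continuousAt.tendsto.mono_left nhdsWithin_le_nhds⟩

/-- A step function `r ↦ g ⌊r n⌋` is càdlàg. -/
theorem isCadlag_floor {E : Type*} [TopologicalSpace E] (n : ℕ) (g : ℕ → E) :
    IsCadlag (fun r : unitInterval => g ⌊(r : ℝ) * n⌋₊) := by
  intro t
  constructor
  · have h1 : Tendsto (fun r : unitInterval => (r : ℝ) * n) (𝓝[≥] t) (𝓝[≥] ((t : ℝ) * n)) := by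
      refine tendsto_nhdsWithin_iff.2 ⟨?_, ?_⟩
      · exact (Continuous.tendsto (by fun_prop) t).mono_left nhdsWithin_le_nhds
      · filter_upwards [self_mem_nhdsWithin] with r hr
        exact mul_le_mul_of_nonneg_right (show (t : ℝ) ≤ r from hr) (Nat.cast_nonneg n)
    have h2 := (tendsto_floor_right_pure_floor ((t : ℝ) * n)).comp h1
    rw [ContinuousWithinAt]
    refine tendsto_nhds_of_eventually_eq ?_
    filter_upwards [tendsto_pure.1 h2] with r hr
    simp only [Function.comp_apply] at hr
    rw [← Int.floor_toNat, ← Int.floor_toNat, hr]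
  · rcases Nat.eq_zero_or_pos n with hn | hn
    · subst hn
      exact ⟨g 0, by simpa using tendsto_const_nhds⟩
    have h1 : Tendsto (fun r : unitInterval => (r : ℝ) * n) (𝓝[<] t) (𝓝[<] ((t : ℝ) * n)) := by
      refine tendsto_nhdsWithin_iff.2 ⟨?_, ?_⟩
      · exact (Continuous.tendsto (by fun_prop) t).mono_left nhdsWithin_le_nhds
      · filter_upwards [self_mem_nhdsWithin] with r hr
        exact mul_lt_mul_of_pos_right (show (r : ℝ) < t from hr) (Nat.cast_pos.2 hn)
    have h2 := (tendsto_floor_left_pure_ceil_sub_one ((t : ℝ) * n)).comp h1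
    refine ⟨g (⌈(t : ℝ) * n⌉ - 1).toNat, tendsto_nhds_of_eventually_eq ?_⟩
    filter_upwards [tendsto_pure.1 h2] with r hr
    simp only [Function.comp_apply] at hr
    rw [← Int.floor_toNat, hr]

/-- The partial sum process `r ↦ n^{-1/2} ∑_{t=1}^{⌊r n⌋} v t` as an element of
`D([0,1]; ℝ^q)`. -/
def partialSumPath {q : ℕ} (n : ℕ) (v : ℕ → EuclideanSpace ℝ (Fin q)) :
    SkorokhodSpace (EuclideanSpace ℝ (Fin q)) where
  toFun r := (√(n : ℝ))⁻¹ • ∑ t ∈ Finset.Icc 1 ⌊(r : ℝ) * n⌋₊, v t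
  isCadlag := isCadlag_floor n (fun k => (√(n : ℝ))⁻¹ • ∑ t ∈ Finset.Icc 1 k, v t)

/-! ### Brownian motion and the limit variable `U_q` -/

/-- `B` is a vector of `q` independent standard Brownian motions with continuous paths. -/
structure IsBrownianVector {Ω' : Type*} [MeasurableSpace Ω'] {q : ℕ}
    (B : Fin q → Ω' → C(ℝ≥0, ℝ)) (P : Measure Ω') : Prop where
  isBrownianReal : ∀ i, IsBrownianReal (fun t ω => B i ω t) P
  indep : iIndepFun (fun i ω (t : ℝ≥0) => B i ω t) P

/-- The path `r ↦ Δ b(r)` on `[0,1]` as an element of `D([0,1]; ℝ^q)`. -/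
def linearPath {q : ℕ} (Δ : Matrix (Fin q) (Fin q) ℝ) (b : Fin q → C(ℝ≥0, ℝ)) :
    SkorokhodSpace (EuclideanSpace ℝ (Fin q)) where
  toFun r := WithLp.toLp 2 (Δ *ᵥ fun i => b i (unitInterval.toNNReal r))
  isCadlag := Continuous.isCadlag (by
    have h : Continuous unitInterval.toNNReal := by fun_prop
    refine (PiLp.continuous_toLp 2 _).comp (Continuous.matrix_mulVec continuous_const ?_)
    exact continuous_pi fun i => (b i).continuous.comp h)

/-- `b_i(r) - r b_i(1)`. -/
def bridge {q : ℕ} (b : Fin q → C(ℝ≥0, ℝ)) (i : Fin q) (r : ℝ) : ℝ :=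
  b i r.toNNReal - r * b i 1

/-- `V_q = ∫_0^1 {b(r) - r b(1)} {b(r) - r b(1)}' dr`. -/
def limitV {q : ℕ} (b : Fin q → C(ℝ≥0, ℝ)) : Matrix (Fin q) (Fin q) ℝ :=
  Matrix.of fun i j => ∫ r in (0 : ℝ)..1, bridge b i r * bridge b j r

/-- `U_q = b(1)' V_q^{-1} b(1)`. -/
def limitU {q : ℕ} (b : Fin q → C(ℝ≥0, ℝ)) : ℝ :=
  (fun i => b i 1) ⬝ᵥ ((limitV b)⁻¹ *ᵥ fun i => b i 1)

/-- The `100(1-α)`th percentile of the real random variable `U`. -/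
def upperPercentile {Ω' : Type*} [MeasurableSpace Ω'] (P : Measure Ω') (U : Ω' → ℝ) (α : ℝ) : ℝ :=
  sInf {x : ℝ | 1 - α ≤ P.real {ω | U ω ≤ x}}

/-! ### Time series, empirical distributions, influence functions -/

/-- Strict stationarity of `(X_t)_{t ∈ ℤ}`. -/
def IsStationary {Ω : Type*} [MeasurableSpace Ω] (μ : Measure Ω) (X : ℤ → Ω → ℝ) : Prop :=
  ∀ k : ℤ, μ.map (fun ω t => X (t + k) ω) = μ.map (fun ω t => X t ω)

/-- The law `F_∞` of the whole series `(X_t)_{t ∈ ℤ}`. -/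
def jointLaw {Ω : Type*} [MeasurableSpace Ω] (μ : Measure Ω) (X : ℤ → Ω → ℝ) :
    Measure (ℤ → ℝ) :=
  μ.map (fun ω t => X t ω)

/-- The vector `(X_a, …, X_{a+b-1})`. -/
def timeBlock {Ω : Type*} (X : ℤ → Ω → ℝ) (b : ℕ) (a : ℤ) (ω : Ω) : Fin b → ℝ :=
  fun i => X (a + (i : ℕ)) ω

/-- The `b`-dimensional marginal law `F_b` of the (stationary) series. -/
def marginalLaw {Ω : Type*} [MeasurableSpace Ω] (μ : Measure Ω) (X : ℤ → Ω → ℝ) (b : ℕ) :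
    Measure (Fin b → ℝ) :=
  μ.map (timeBlock X b 1)

/-- The backward block `(X_{t-b+1}, …, X_t)`. -/
def lagBlock {Ω : Type*} (X : ℤ → Ω → ℝ) (b : ℕ) (t : ℕ) (ω : Ω) : Fin b → ℝ :=
  timeBlock X b ((t : ℤ) - b + 1) ω

/-- The empirical distribution `N^{-1} ∑_{t=1}^N δ_{y_t}` (used for `N ≥ 1`). -/
def empiricalMeasure {S : Type*} [MeasurableSpace S] (N : ℕ) (y : ℕ → S) : Measure S :=
  (N : ℝ≥0∞)⁻¹ • ∑ t ∈ Finset.Icc 1 N, Measure.dirac (y t)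

/-- `IF` is the influence function of the functional `T` at `F`:
`IF(y) = lim_{ε ↓ 0} [T{(1-ε) F + ε δ_y} - T(F)] / ε` for `F`-almost every `y`. -/
def IsInfluenceFunction {S E : Type*} [MeasurableSpace S] [NormedAddCommGroup E]
    [NormedSpace ℝ E] (T : Measure S → E) (F : Measure S) (IF : S → E) : Prop :=
  ∀ᵐ y ∂F, Tendsto
    (fun ε : ℝ => ε⁻¹ •
      (T (ENNReal.ofReal (1 - ε) • F + ENNReal.ofReal ε • Measure.dirac y) - T F))
    (𝓝[>] 0) (𝓝 (IF y))

/-- `Z_n = o_p(a_n)`. -/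
def IsLittleOP {Ω E : Type*} [MeasurableSpace Ω] [NormedAddCommGroup E] [NormedSpace ℝ E]
    (μ : Measure Ω) (Z : ℕ → Ω → E) (a : ℕ → ℝ) : Prop :=
  TendstoInMeasure μ (fun n ω => (a n)⁻¹ • Z n ω) atTop (fun _ => 0)

/-! ### Recursive estimates and the self-normalized statistic -/

/-- The estimate `S_t(ρ_t^1)` based on `(X_1, …, X_t)`: the functional `S_t` of `t`-dimensional
distributions at the empirical distribution of the single block `(X_1, …, X_t)`. -/
def recursiveEstimate {Ω E : Type*} (S : (t : ℕ) → Measure (Fin t → ℝ) → E)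
    (X : ℤ → Ω → ℝ) (ω : Ω) (t : ℕ) : E :=
  S t (empiricalMeasure 1 (fun s => timeBlock X t (s : ℤ) ω))

/-- `W_n = n^{-2} ∑_{t=1}^n t² (θ̂_t - θ̂_n)(θ̂_t - θ̂_n)'`. -/
def normMatrix {q : ℕ} (θhat : ℕ → EuclideanSpace ℝ (Fin q)) (n : ℕ) :
    Matrix (Fin q) (Fin q) ℝ :=
  Matrix.of fun i j => ((n : ℝ) ^ 2)⁻¹ *
    ∑ t ∈ Finset.Icc 1 n, (t : ℝ) ^ 2 * ((θhat t i - θhat n i) * (θhat t j - θhat n j))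

/-- `n (θ̂_n - ϑ)' W_n^{-1} (θ̂_n - ϑ)`. -/
def selfNormStat {q : ℕ} (θhat : ℕ → EuclideanSpace ℝ (Fin q))
    (ϑ : EuclideanSpace ℝ (Fin q)) (n : ℕ) : ℝ :=
  (n : ℝ) * ((fun i => θhat n i - ϑ i) ⬝ᵥ ((normMatrix θhat n)⁻¹ *ᵥ fun i => θhat n i - ϑ i))

/-- The confidence region `{ϑ : n (θ̂_n - ϑ)' W_n^{-1} (θ̂_n - ϑ) ≤ u}`. -/
def confidenceRegion {q : ℕ} (θhat : ℕ → EuclideanSpace ℝ (Fin q)) (u : ℝ) (n : ℕ) :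
    Set (EuclideanSpace ℝ (Fin q)) :=
  {ϑ | selfNormStat θhat ϑ n ≤ u}

end SelfNorm

end

/-!
The self-normalized statistic `n (θ̂_n - θ)' W_n⁻¹ (θ̂_n - θ)` is the image of the pair
`(√n (θ̂_n - θ), W_n)` (`scaledPair`) under `(x, M) ↦ x' M⁻¹ x`. Up to errors that vanish in
probability, that pair is the value of a fixed functional of the partial sum path of the influence
functions, namely `endpointGram x = (x(1), ∫ {x(r) - r x(1)} {x(r) - r x(1)}' dr)`: the step path
`r ↦ n^{-1/2} ⌊rn⌋ (θ̂_{⌊rn⌋} - θ̂_n)` has Gram matrix exactly `W_n`, and the bounds on the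
remainders say that it is close in mean square to the tied-down partial sum path
(`integral_sq_estimatePath_sub_le`, `abs_integral_mul_sub_le`).

The functional is continuous on the whole Skorokhod space (`continuous_endpointGram`): evaluation at
`1` is Lipschitz, evaluation at `t` is continuous at paths continuous at `t`, a càdlàg path has only
countably many jumps, and dominated convergence does the rest. Hence the functional central limit
theorem gives joint convergence to `(Δ B(1), Δ V_q Δ')` (`tendstoInDistribution_scaledPair`), and
the continuous mapping theorem for almost everywhere continuous maps gives convergence of the
statistic, `Δ` cancelling out.

Two facts about Brownian motion are needed. First, `V_q` is almost surely positive definite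
(`ae_posDef_limitV`). It is the Gram matrix of the `q` bridges, and these are linearly
independent because the matrix of their second differences over a grid is almost surely invertible:
its rows are independent, and each one almost surely avoids any given hyperplane. Second,
`U_q` has no atoms (`ae_limitU_ne`), so that its distribution function attains `1 - α` at the
percentile: the end value of one of the Brownian motions is independent of all bridges
and of the other end values, and given these `U_q` is a genuine quadratic polynomial in it.
-/

namespace SelfNorm

/-! ### Càdlàg functions -/

theorem IsCadlag.exists_norm_le {E : Type*} [SeminormedAddCommGroup E] {f : unitInterval → E}
    (hf : IsCadlag f) : ∃ C, ∀ t, ‖f t‖ ≤ C := by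
  have key : ∃ C, ∀ t ∈ (Set.univ : Set unitInterval), ‖f t‖ ≤ C := by
    refine isCompact_univ.induction_on (p := fun s => ∃ C, ∀ t ∈ s, ‖f t‖ ≤ C) ⟨0, by simp⟩
      ?_ ?_ ?_
    · rintro s t hst ⟨C, hC⟩
      exact ⟨C, fun x hx => hC x (hst hx)⟩
    · rintro s t ⟨C, hC⟩ ⟨C', hC'⟩
      refine ⟨max C C', ?_⟩
      rintro x (hx | hx)
      · exact (hC x hx).trans (le_max_left _ _)
      · exact (hC' x hx).trans (le_max_right _ _)
    · intro t _
      obtain ⟨hr, l, hl⟩ := hf t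
      have h1 : ∀ᶠ s in 𝓝[<] t, ‖f s‖ ≤ ‖l‖ + 1 :=
        (hl.norm.eventually (gt_mem_nhds (lt_add_one _))).mono fun _ h => le_of_lt h
      have h2 : ∀ᶠ s in 𝓝[≥] t, ‖f s‖ ≤ ‖f t‖ + 1 :=
        (hr.norm.eventually (gt_mem_nhds (lt_add_one _))).mono fun _ h => le_of_lt h
      have h3 : ∀ᶠ s in 𝓝 t, ‖f s‖ ≤ max (‖l‖ + 1) (‖f t‖ + 1) := by
        rw [← nhdsLT_sup_nhdsGE, eventually_sup]
        exact ⟨h1.mono fun _ h => h.trans (le_max_left _ _),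
          h2.mono fun _ h => h.trans (le_max_right _ _)⟩
      exact ⟨_, mem_nhdsWithin_of_mem_nhds h3, _, fun s hs => hs⟩
  obtain ⟨C, hC⟩ := key
  exact ⟨C, fun t => hC t trivial⟩

theorem IsCadlag.comp_continuous {E F : Type*} [TopologicalSpace E] [TopologicalSpace F]
    {f : unitInterval → E} (hf : IsCadlag f) {g : E → F} (hg : Continuous g) :
    IsCadlag (fun t => g (f t)) := fun t =>
  ⟨hg.continuousAt.comp_continuousWithinAt (hf t).1,
    (hf t).2.elim fun l hl => ⟨g l, (hg.tendsto l).comp hl⟩⟩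

theorem IsCadlag.prodMk {E F : Type*} [TopologicalSpace E] [TopologicalSpace F]
    {f : unitInterval → E} {g : unitInterval → F} (hf : IsCadlag f) (hg : IsCadlag g) :
    IsCadlag (fun t => (f t, g t)) := fun t =>
  ⟨(hf t).1.prodMk (hg t).1, by
    obtain ⟨l, hl⟩ := (hf t).2
    obtain ⟨m, hm⟩ := (hg t).2
    exact ⟨(l, m), hl.prodMk_nhds hm⟩⟩

theorem IsCadlag.sub {f g : unitInterval → ℝ} (hf : IsCadlag f) (hg : IsCadlag g) :
    IsCadlag (fun t => f t - g t) :=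
  (hf.prodMk hg).comp_continuous continuous_sub

theorem IsCadlag.mul {f g : unitInterval → ℝ} (hf : IsCadlag f) (hg : IsCadlag g) :
    IsCadlag (fun t => f t * g t) :=
  (hf.prodMk hg).comp_continuous continuous_mul

/-- A real càdlàg function has at most countably many discontinuities: at each of them the value
is separated by a gap from the values just to the left. -/
theorem IsCadlag.countable_not_continuousAt {f : unitInterval → ℝ} (hf : IsCadlag f) :
    {t | ¬ ContinuousAt f t}.Countable := by
  have hsub : {t | ¬ ContinuousAt f t} ⊆
      (⋃ p ∈ {p : unitInterval | ∃ r : ℚ, (p : ℝ) = r},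
        ({t ∈ Set.Ioi p | ∃ z, f t < z ∧ ∀ y ∈ Set.Ioi p, y < t → z ≤ f y} ∪
         {t ∈ Set.Ioi p | ∃ z, z < f t ∧ ∀ y ∈ Set.Ioi p, y < t → f y ≤ z})) ∪ {0} := by
    intro t ht
    rcases eq_or_ne t 0 with h0 | h0
    · exact Or.inr h0
    left
    obtain ⟨hr, l, hl⟩ := hf t
    have hne : l ≠ f t := by
      rintro rfl
      apply ht
      rw [ContinuousAt, ← nhdsLT_sup_nhdsGE]
      exact hl.sup hr
    have hpos : (0 : unitInterval) < t := unitInterval.pos_iff_ne_zero.2 h0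
    -- any property holding just to the left of `t` holds on `(p, t)` for a rational `p`
    have hrat : ∀ s ∈ 𝓝[<] t, ∃ p : unitInterval, (∃ r : ℚ, (p : ℝ) = r) ∧ p < t ∧
        ∀ y, p < y → y < t → y ∈ s := by
      intro s hs
      obtain ⟨a, ha, has⟩ := (mem_nhdsLT_iff_exists_Ioo_subset' hpos).1 hs
      obtain ⟨r, hr1, hr2⟩ := exists_rat_btwn (show (a : ℝ) < t from ha)
      exact ⟨⟨r, (a.2.1.trans hr1.le), hr2.le.trans t.2.2⟩, ⟨r, rfl⟩, hr2,
        fun y h1 h2 => has ⟨lt_trans (show a < ⟨(r : ℝ), _⟩ from hr1) h1, h2⟩⟩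
    simp only [Set.mem_iUnion]
    rcases lt_or_gt_of_ne hne with h | h
    · obtain ⟨z, hz1, hz2⟩ := exists_between h
      obtain ⟨p, hp, hpt, hps⟩ := hrat _ (hl.eventually (gt_mem_nhds hz1))
      exact ⟨p, hp, Or.inr ⟨hpt, z, hz2, fun y hy hyt => le_of_lt (hps y hy hyt)⟩⟩
    · obtain ⟨z, hz1, hz2⟩ := exists_between h
      obtain ⟨p, hp, hpt, hps⟩ := hrat _ (hl.eventually (lt_mem_nhds hz2))
      exact ⟨p, hp, Or.inl ⟨hpt, z, hz1, fun y hy hyt => le_of_lt (hps y hy hyt)⟩⟩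
  refine Set.Countable.mono hsub (Set.Countable.union (Set.Countable.biUnion ?_ ?_)
    (Set.countable_singleton 0))
  · refine Set.MapsTo.countable_of_injOn (t := Set.range ((↑) : ℚ → ℝ))
      (f := ((↑) : unitInterval → ℝ)) ?_ Subtype.val_injective.injOn (Set.countable_range _)
    rintro p ⟨r, hr⟩
    exact ⟨r, hr.symm⟩
  · intro p _
    exact (countable_image_gt_image_Iio_within _ f).union (countable_image_lt_image_Iio_within _ f)

theorem IsCadlag.ae_continuousAt {f : unitInterval → ℝ} (hf : IsCadlag f) :
    ∀ᵐ t : unitInterval, ContinuousAt f t := hf.countable_not_continuousAt.measure_zero _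

theorem IsCadlag.aestronglyMeasurable {f : unitInterval → ℝ} (hf : IsCadlag f) :
    AEStronglyMeasurable f (volume : Measure unitInterval) := by
  have hc := hf.countable_not_continuousAt
  have hm : MeasurableSet {t | ¬ ContinuousAt f t}ᶜ := hc.measurableSet.compl
  have h : ContinuousOn f {t | ¬ ContinuousAt f t}ᶜ := fun t ht =>
    (not_not.1 ht : ContinuousAt f t).continuousWithinAt
  have h2 := h.aestronglyMeasurable (μ := volume) hm
  rwa [Measure.restrict_eq_self_of_ae_mem] at h2
  exact hc.measure_zero _ |> fun h0 => by
    rw [ae_iff]; simpa using h0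

theorem IsCadlag.integrable {f : unitInterval → ℝ} (hf : IsCadlag f) :
    Integrable f (volume : Measure unitInterval) := by
  obtain ⟨C, hC⟩ := hf.exists_norm_le
  exact Integrable.of_bound hf.aestronglyMeasurable C (Eventually.of_forall hC)

theorem integral_unitInterval {F : Type*} [NormedAddCommGroup F] [NormedSpace ℝ F] (f : ℝ → F) :
    ∫ r : unitInterval, f r = ∫ r in (0 : ℝ)..1, f r := by
  rw [intervalIntegral.integral_of_le zero_le_one, ← integral_Icc_eq_integral_Ioc]
  exact integral_subtype measurableSet_Icc f

/-- The integral of a step function with steps of length `1 / n`. -/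
theorem integral_floor (n : ℕ) (hn : 0 < n) (g : ℕ → ℝ) :
    ∫ r : unitInterval, g ⌊(r : ℝ) * n⌋₊ = (n : ℝ)⁻¹ * ∑ k ∈ Finset.range n, g k := by
  rw [integral_unitInterval (fun r => g ⌊r * n⌋₊)]
  have hn' : (0 : ℝ) < n := Nat.cast_pos.2 hn
  have hae : ∀ k : ℕ, ∀ᵐ r ∂(volume : Measure ℝ), r ∈ Set.uIoc ((k : ℝ) / n) ((k + 1 : ℕ) / n) →
      (fun _ => g k) r = g ⌊r * n⌋₊ := by
    intro k
    have : ∀ᵐ r ∂(volume : Measure ℝ), r ≠ ((k + 1 : ℕ) : ℝ) / n := by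
      simp [ae_iff]
    filter_upwards [this] with r hr hmem
    rw [Set.uIoc_of_le (by gcongr; exact Nat.le_succ k)] at hmem
    have h1 := (div_lt_iff₀ hn').1 hmem.1
    have h2 := (lt_div_iff₀ hn').1 (lt_of_le_of_ne hmem.2 hr)
    congr 1
    symm
    rw [Nat.floor_eq_iff ((Nat.cast_nonneg k).trans h1.le)]
    exact ⟨h1.le, by exact_mod_cast h2⟩
  have hint : ∀ k < n, IntervalIntegrable (fun r : ℝ => g ⌊r * n⌋₊) volume
      ((k : ℝ) / n) ((k + 1 : ℕ) / n) := by
    intro k _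
    exact (intervalIntegrable_const (c := g k)).congr_ae
      ((ae_restrict_iff' measurableSet_uIoc).2 (hae k))
  have hsum := intervalIntegral.sum_integral_adjacent_intervals (a := fun k : ℕ => (k : ℝ) / n) hint
  have h01 : ((0 : ℕ) : ℝ) / n = 0 := by simp
  have h11 : ((n : ℕ) : ℝ) / n = 1 := by field_simp
  simp only [h01, h11] at hsum
  rw [← hsum, Finset.mul_sum]
  refine Finset.sum_congr rfl fun k _ => ?_
  rw [← intervalIntegral.integral_congr_ae (hae k), intervalIntegral.integral_const, smul_eq_mul]
  push_cast
  field_simp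
  ring

/-! ### Continuity of the limit functional on the Skorokhod space -/

theorem SkorokhodSpace.edist_eval_one_le {E : Type*} [PseudoEMetricSpace E]
    (x y : SkorokhodSpace E) : edist (x 1) (y 1) ≤ edist x y := by
  refine le_iInf fun l => ?_
  refine le_max_of_le_right ?_
  have h := le_iSup (fun t => edist (x t) (y (l t))) 1
  have h1 : l 1 = 1 := l.map_top
  simpa [h1] using h

theorem SkorokhodSpace.continuous_eval_one {E : Type*} [PseudoEMetricSpace E] :
    Continuous (fun x : SkorokhodSpace E => x 1) :=
  (LipschitzWith.of_edist_le (fun x y => SkorokhodSpace.edist_eval_one_le x y)).continuous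

/-- Evaluation at `t` is continuous at every path that is continuous at `t`. -/
theorem SkorokhodSpace.tendsto_eval {E : Type*} [PseudoEMetricSpace E]
    (x : SkorokhodSpace E) (t : unitInterval) (hx : ContinuousAt x.toFun t) :
    Tendsto (fun y : SkorokhodSpace E => y t) (𝓝 x) (𝓝 (x t)) := by
  rw [EMetric.tendsto_nhds]
  intro ε hε
  have hε2 : 0 < ε / 2 := ENNReal.half_pos hε.ne'
  obtain ⟨δ, hδ, hδx⟩ := EMetric.continuousAt_iff.1 hx (ε / 2) hε2
  filter_upwards [Metric.eball_mem_nhds x (lt_min hδ hε2)] with y hy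
  obtain ⟨l, hl⟩ := iInf_lt_iff.1 (show (⨅ l, skorokhodCost y x l) < min δ (ε / 2) from hy)
  have h1 : edist (l t) t < δ := lt_of_le_of_lt
    ((le_iSup (fun t => edist (l t) t) t).trans (le_max_left _ _)) (hl.trans_le (min_le_left _ _))
  have h2 : edist (y t) (x (l t)) < ε / 2 := lt_of_le_of_lt
    ((le_iSup (fun t => edist (y t) (x (l t))) t).trans (le_max_right _ _))
    (hl.trans_le (min_le_right _ _))
  calc edist (y t) (x t) ≤ edist (y t) (x (l t)) + edist (x (l t)) (x t) := edist_triangle _ _ _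
    _ < ε / 2 + ε / 2 := ENNReal.add_lt_add h2 (hδx h1)
    _ = ε := ENNReal.add_halves ε

theorem SkorokhodSpace.eventually_norm_le {E : Type*} [SeminormedAddCommGroup E]
    (x : SkorokhodSpace E) : ∃ C, ∀ᶠ y in 𝓝 x, ∀ t, ‖y.toFun t‖ ≤ C := by
  obtain ⟨C, hC⟩ := x.isCadlag.exists_norm_le
  refine ⟨C + 1, ?_⟩
  filter_upwards [Metric.eball_mem_nhds x one_pos] with y hy t
  obtain ⟨l, hl⟩ := iInf_lt_iff.1 (show (⨅ l, skorokhodCost y x l) < 1 from hy)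
  have h2 : edist (y t) (x (l t)) < 1 := lt_of_le_of_lt
    ((le_iSup (fun t => edist (y t) (x (l t))) t).trans (le_max_right _ _)) hl
  rw [edist_dist, ENNReal.ofReal_lt_one, dist_eq_norm] at h2
  calc ‖y t‖ = ‖x (l t) + (y t - x (l t))‖ := by congr 1; abel
    _ ≤ C + 1 := (norm_add_le _ _).trans (add_le_add (hC _) h2.le)

/-- The `i`-th coordinate `x_i(r) - r x_i(1)` of the tied-down path. -/
noncomputable def tiedDown {q : ℕ} (x : unitInterval → EuclideanSpace ℝ (Fin q)) (i : Fin q)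
    (r : unitInterval) : ℝ := x r i - r * x 1 i

theorem IsCadlag.tiedDown {q : ℕ} {x : unitInterval → EuclideanSpace ℝ (Fin q)}
    (hx : IsCadlag x) (i : Fin q) : IsCadlag (tiedDown x i) :=
  (hx.comp_continuous (g := fun v => v i) (by fun_prop)).sub
    ((Continuous.isCadlag continuous_subtype_val).mul
      (Continuous.isCadlag (continuous_const (y := x 1 i))))

/-- The end point `x(1)` of a path and the matrix
`∫_0^1 {x(r) - r x(1)} {x(r) - r x(1)}' dr`. -/
noncomputable def endpointGram {q : ℕ} (x : SkorokhodSpace (EuclideanSpace ℝ (Fin q))) :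
    EuclideanSpace ℝ (Fin q) × (Fin q → Fin q → ℝ) :=
  (x 1, fun i j => ∫ r : unitInterval, tiedDown x.toFun i r * tiedDown x.toFun j r)

theorem continuous_endpointGram {q : ℕ} :
    Continuous (endpointGram (q := q)) := by
  refine SkorokhodSpace.continuous_eval_one.prodMk
    (continuous_pi fun i => continuous_pi fun j => continuous_iff_continuousAt.2 fun x => ?_)
  obtain ⟨C, hC⟩ := x.eventually_norm_le
  have hb : ∀ y : SkorokhodSpace (EuclideanSpace ℝ (Fin q)), (∀ t, ‖y.toFun t‖ ≤ C) →
      ∀ i (r : unitInterval), ‖tiedDown y.toFun i r‖ ≤ C + C := by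
    intro y hy i r
    refine (norm_sub_le _ _).trans (add_le_add ((PiLp.norm_apply_le _ i).trans (hy r)) ?_)
    rw [norm_mul]
    have h1 : ‖(r : ℝ)‖ ≤ 1 := by
      rw [Real.norm_of_nonneg r.2.1]; exact r.2.2
    calc ‖(r : ℝ)‖ * ‖y.toFun 1 i‖ ≤ 1 * C :=
          mul_le_mul h1 ((PiLp.norm_apply_le _ i).trans (hy 1)) (norm_nonneg _) zero_le_one
      _ = C := one_mul C
  refine tendsto_integral_filter_of_dominated_convergence (fun _ => (C + C) * (C + C)) ?_ ?_
    (integrable_const _) ?_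
  · exact Eventually.of_forall fun y =>
      ((y.isCadlag.tiedDown i).mul (y.isCadlag.tiedDown j)).aestronglyMeasurable
  · filter_upwards [hC] with y hy
    refine Eventually.of_forall fun r => ?_
    rw [norm_mul]
    exact mul_le_mul (hb y hy i r) (hb y hy j r) (norm_nonneg _)
      ((norm_nonneg _).trans (hb y hy i r))
  · have hae : ∀ᵐ r : unitInterval, ∀ k, ContinuousAt (fun s => x.toFun s k) r :=
      ae_all_iff.2 fun k =>
        (x.isCadlag.comp_continuous (g := fun v => v k) (by fun_prop)).ae_continuousAt
    filter_upwards [hae] with r hr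
    have hxr : ContinuousAt x.toFun r :=
      (PiLp.continuous_toLp 2 (fun _ : Fin q => ℝ)).continuousAt.comp
        (continuousAt_pi.2 hr)
    have hev := x.tendsto_eval r hxr
    have hev1 : Tendsto (fun y : SkorokhodSpace (EuclideanSpace ℝ (Fin q)) => y 1) (𝓝 x)
      (𝓝 (x 1)) := SkorokhodSpace.continuous_eval_one.tendsto x
    have hk : ∀ k, Tendsto (fun y : SkorokhodSpace (EuclideanSpace ℝ (Fin q)) =>
        tiedDown y.toFun k r) (𝓝 x) (𝓝 (tiedDown x.toFun k r)) := fun k =>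
      (((continuous_apply k).comp (PiLp.continuous_ofLp 2 _)).tendsto _ |>.comp hev).sub
        ((((continuous_apply k).comp (PiLp.continuous_ofLp 2 _)).tendsto _ |>.comp hev1).const_mul _)
    exact (hk i).mul (hk j)

/-! ### Convergence in distribution and in probability -/

section Convergence

variable {ι Ω Ω' E F : Type*} [MeasurableSpace Ω] {μ : Measure Ω} [IsProbabilityMeasure μ]
  [MeasurableSpace Ω'] {P : Measure Ω'} [IsProbabilityMeasure P] {l : Filter ι}
  [TopologicalSpace E] [MeasurableSpace E] [BorelSpace E] [HasOuterApproxClosed E]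
  {X : ι → Ω → E} {Z : Ω' → E}

theorem limsup_measure_preimage_le (h : TendstoInDistribution X l Z (fun _ => μ) P) {S : Set E}
    (hS : IsClosed S) : limsup (fun n => μ (X n ⁻¹' S)) l ≤ P (Z ⁻¹' S) := by
  have h1 := ProbabilityMeasure.limsup_measure_closed_le_of_tendsto h.tendsto hS
  simp only [ProbabilityMeasure.coe_mk] at h1
  rw [Measure.map_apply_of_aemeasurable h.aemeasurable_limit hS.measurableSet] at h1
  refine le_trans (le_of_eq ?_) h1
  congr 1
  ext n
  rw [Measure.map_apply_of_aemeasurable (h.forall_aemeasurable n) hS.measurableSet]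

theorem tendsto_measure_preimage (h : TendstoInDistribution X l Z (fun _ => μ) P) {S : Set E}
    (hS : MeasurableSet S) (hfr : P (Z ⁻¹' frontier S) = 0) :
    Tendsto (fun n => μ.real (X n ⁻¹' S)) l (𝓝 (P.real (Z ⁻¹' S))) := by
  have h1 := ProbabilityMeasure.tendsto_measure_of_null_frontier_of_tendsto' h.tendsto (E := S) (by
    simp only [ProbabilityMeasure.coe_mk]
    rwa [Measure.map_apply_of_aemeasurable h.aemeasurable_limit isClosed_frontier.measurableSet])
  simp only [ProbabilityMeasure.coe_mk] at h1
  rw [Measure.map_apply_of_aemeasurable h.aemeasurable_limit hS] at h1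
  refine (ENNReal.tendsto_toReal (measure_ne_top _ _)).comp (h1.congr fun n => ?_)
  rw [Measure.map_apply_of_aemeasurable (h.forall_aemeasurable n) hS]

/-- The continuous mapping theorem for a measurable map that is continuous at almost every value
of the limit. -/
theorem _root_.MeasureTheory.TendstoInDistribution.comp_of_ae_continuousAt
    [l.IsCountablyGenerated]
    [TopologicalSpace F] [MeasurableSpace F] [BorelSpace F]
    (h : TendstoInDistribution X l Z (fun _ => μ) P) {g : E → F} (hg : Measurable g)
    (hgc : ∀ᵐ ω ∂P, ContinuousAt g (Z ω)) :
    TendstoInDistribution (fun n ω => g (X n ω)) l (fun ω => g (Z ω)) (fun _ => μ) P where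
  forall_aemeasurable n := hg.comp_aemeasurable (h.forall_aemeasurable n)
  aemeasurable_limit := hg.comp_aemeasurable h.aemeasurable_limit
  tendsto := by
    refine tendsto_of_forall_isClosed_limsup_le' fun S hS => ?_
    simp only [ProbabilityMeasure.coe_mk]
    have hgZ : AEMeasurable (fun ω => g (Z ω)) P := hg.comp_aemeasurable h.aemeasurable_limit
    have hgX : ∀ n, AEMeasurable (fun ω => g (X n ω)) μ := fun n =>
      hg.comp_aemeasurable (h.forall_aemeasurable n)
    rw [Measure.map_apply_of_aemeasurable hgZ hS.measurableSet]
    have hle : P (Z ⁻¹' closure (g ⁻¹' S)) ≤ P ((fun ω => g (Z ω)) ⁻¹' S) := by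
      refine measure_mono_ae ?_
      filter_upwards [hgc] with ω hω hmem
      exact hS.closure_subset (hω.continuousWithinAt.mem_closure hmem (fun _ hx => hx))
    refine le_trans ?_ ((limsup_measure_preimage_le h isClosed_closure).trans hle)
    refine limsup_le_limsup (Eventually.of_forall fun n => ?_)
    show (μ.map fun ω => g (X n ω)) S ≤ _
    rw [Measure.map_apply_of_aemeasurable (hgX n) hS.measurableSet]
    exact measure_mono fun ω hω => subset_closure hω

/-- Real random variables converging in distribution are bounded in probability. -/
theorem eventually_measure_ge_le {A : ι → Ω → ℝ} {A' : Ω' → ℝ}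
    (h : TendstoInDistribution A l A' (fun _ => μ) P) {ε : ℝ≥0∞} (hε : 0 < ε) :
    ∃ M : ℝ, ∀ᶠ n in l, μ {ω | M ≤ A n ω} ≤ ε := by
  have hlim : Tendsto (fun k : ℕ => P (A' ⁻¹' Set.Ici (k : ℝ))) atTop
      (𝓝 (P (⋂ k : ℕ, A' ⁻¹' Set.Ici (k : ℝ)))) := by
    refine tendsto_measure_iInter_atTop
      (fun k => h.aemeasurable_limit.nullMeasurable measurableSet_Ici) ?_ ⟨0, measure_ne_top _ _⟩
    intro a b hab ω hω
    exact le_trans (by exact_mod_cast hab) (show (b : ℝ) ≤ A' ω from hω)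
  have hempty : (⋂ k : ℕ, A' ⁻¹' Set.Ici (k : ℝ)) = ∅ := by
    refine Set.eq_empty_of_forall_notMem fun ω hω => ?_
    obtain ⟨k, hk⟩ := exists_nat_gt (A' ω)
    exact absurd (Set.mem_iInter.1 hω k) (not_le.2 hk)
  rw [hempty, measure_empty] at hlim
  obtain ⟨k, hk⟩ := (hlim.eventually (gt_mem_nhds hε)).exists
  refine ⟨k, ?_⟩
  have h1 := (limsup_measure_preimage_le h (isClosed_Ici (a := (k : ℝ)))).trans_lt hk
  exact (eventually_lt_of_limsup_lt h1).mono fun n hn => hn.le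

end Convergence

/-- If `A_n` converges in distribution, `C_n → 0` in probability, and `D_n` is small where `A_n` is
bounded and `C_n` is small, then `D_n → 0` in probability. -/
theorem tendstoInMeasure_zero_of_bounded {ι Ω Ω' E : Type*} [MeasurableSpace Ω] {μ : Measure Ω}
    [IsProbabilityMeasure μ] [MeasurableSpace Ω'] {P : Measure Ω'} [IsProbabilityMeasure P]
    {l : Filter ι} [SeminormedAddCommGroup E] {A : ι → Ω → ℝ} {A' : Ω' → ℝ}
    (hA : TendstoInDistribution A l A' (fun _ => μ) P) {C : ι → Ω → ℝ}
    (hC : TendstoInMeasure μ C l (fun _ => 0)) {D : ι → Ω → E}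
    (hD : ∀ M ε : ℝ, 0 < ε → ∃ δ > 0, ∀ᶠ n in l, ∀ ω, A n ω < M → |C n ω| < δ → ‖D n ω‖ < ε) :
    TendstoInMeasure μ D l (fun _ => 0) := by
  rw [tendstoInMeasure_iff_norm] at hC ⊢
  intro ε hε
  rw [ENNReal.tendsto_nhds_zero]
  intro η hη
  have hη2 : 0 < η / 2 := ENNReal.half_pos hη.ne'
  obtain ⟨M, hM⟩ := eventually_measure_ge_le hA hη2
  obtain ⟨δ, hδ, hDδ⟩ := hD M ε hε
  filter_upwards [hM, hDδ, (ENNReal.tendsto_nhds_zero.1 (hC δ hδ)) _ hη2] with n h1 h2 h3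
  calc μ {ω | ε ≤ ‖D n ω - 0‖} ≤ μ ({ω | M ≤ A n ω} ∪ {ω | δ ≤ ‖C n ω - 0‖}) := by
        refine measure_mono fun ω hω => ?_
        by_contra hcon
        simp only [Set.mem_union, Set.mem_ofPred_eq, not_or, not_le, sub_zero,
          Real.norm_eq_abs] at hcon
        have := h2 ω hcon.1 hcon.2
        simp only [Set.mem_ofPred_eq, sub_zero] at hω
        linarith
    _ ≤ η / 2 + η / 2 := (measure_union_le _ _).trans (add_le_add h1 h3)
    _ = η := ENNReal.add_halves η

theorem _root_.MeasureTheory.TendstoInMeasure.add_of_zero {ι Ω : Type*} [MeasurableSpace Ω]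
    {μ : Measure Ω} {l : Filter ι} {C D : ι → Ω → ℝ}
    (hC : TendstoInMeasure μ C l (fun _ => 0)) (hD : TendstoInMeasure μ D l (fun _ => 0)) :
    TendstoInMeasure μ (fun n ω => C n ω + D n ω) l (fun _ => 0) := by
  rw [tendstoInMeasure_iff_norm] at hC hD ⊢
  intro ε hε
  have h := (hC (ε / 2) (half_pos hε)).add (hD (ε / 2) (half_pos hε))
  rw [_root_.add_zero] at h
  refine tendsto_of_tendsto_of_tendsto_of_le_of_le tendsto_const_nhds h (fun _ => zero_le)
    fun n => (measure_mono fun ω hω => ?_).trans (measure_union_le _ _)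
  by_contra hcon
  simp only [Set.mem_union, Set.mem_ofPred_eq, not_or, not_le, sub_zero] at hcon hω
  linarith [norm_add_le (C n ω) (D n ω)]

/-! ### Independence and null sets -/

theorem ae_map_ne_zero_iff {Ω β : Type*} [MeasurableSpace Ω] [MeasurableSpace β] {P : Measure Ω}
    {f : Ω → β} (hf : AEMeasurable f P) {g : β → ℝ} (hg : Measurable g) :
    (∀ᵐ y ∂P.map f, g y ≠ 0) ↔ ∀ᵐ ω ∂P, g (f ω) ≠ 0 :=
  ae_map_iff hf (hg (measurableSet_singleton 0).compl)

theorem measurable_matrix_det (n : ℕ) :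
    Measurable fun N : Fin n → Fin n → ℝ => (Matrix.of N).det := by
  have h : Continuous fun N : Fin n → Fin n → ℝ => (Matrix.of N).det :=
    Continuous.matrix_det continuous_id
  exact h.measurable

/-- If every section of `S` over a value of `Y` is countable and `X` has no atoms and is independent
of `Y`, then `(X, Y)` almost surely avoids `S`. -/
theorem ae_notMem_of_indepFun {Ω β : Type*} [MeasurableSpace Ω] [MeasurableSpace β]
    {P : Measure Ω} [IsProbabilityMeasure P] {X : Ω → ℝ} {Y : Ω → β} (h : IndepFun X Y P)
    (hX : AEMeasurable X P) (hY : AEMeasurable Y P) [NullSingletonClass (P.map X)]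
    {S : Set (ℝ × β)} (hS : MeasurableSet S)
    (hsec : ∀ᵐ ω ∂P, {x | (x, Y ω) ∈ S}.Countable) : ∀ᵐ ω ∂P, (X ω, Y ω) ∉ S := by
  have : IsProbabilityMeasure (P.map X) := Measure.isProbabilityMeasure_map hX
  have : IsProbabilityMeasure (P.map Y) := Measure.isProbabilityMeasure_map hY
  have hlaw := (indepFun_iff_map_prod_eq_prod_map_map hX hY).1 h
  have h0 : (P.map fun ω => (X ω, Y ω)) S = 0 := by
    rw [hlaw, Measure.prod_apply_symm hS, lintegral_eq_zero_iff (measurable_measure_prodMk_right hS)]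
    refine (ae_map_iff hY ((measurable_measure_prodMk_right hS) (measurableSet_singleton 0))).2 ?_
    filter_upwards [hsec] with ω hω
    exact hω.measure_zero _
  rw [Measure.map_apply_of_aemeasurable (hX.prodMk hY) hS] at h0
  exact measure_eq_zero_iff_ae_notMem.1 h0

/-- A random matrix with independent rows has full rank almost surely, provided that each row
almost surely avoids any given hyperplane. -/
theorem ae_det_ne_zero_pi : ∀ (n : ℕ) (ν : Fin n → Measure (Fin n → ℝ))
    [∀ i, IsProbabilityMeasure (ν i)],
    (∀ i (a : Fin n → ℝ), a ≠ 0 → ∀ᵐ x ∂ν i, ∑ k, a k * x k ≠ 0) →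
    ∀ᵐ N ∂Measure.pi ν, (Matrix.of N).det ≠ 0
  | 0, ν, _, _ => by simp
  | n + 1, ν, _, h => by
    have hf : Measurable fun (x : Fin (n + 1) → ℝ) (j : Fin n) => x j.succ :=
      measurable_pi_lambda _ fun j => measurable_pi_apply _
    have hprob : ∀ i : Fin n,
        IsProbabilityMeasure ((ν i.succ).map fun x (j : Fin n) => x j.succ) :=
      fun i => Measure.isProbabilityMeasure_map hf.aemeasurable
    have ih := ae_det_ne_zero_pi n (fun i => (ν i.succ).map fun x (j : Fin n) => x j.succ) (by
      intro i a ha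
      have hm : Measurable fun x : Fin n → ℝ => ∑ k, a k * x k :=
        Finset.measurable_sum _ fun k _ => (measurable_pi_apply k).const_mul _
      rw [ae_map_ne_zero_iff hf.aemeasurable hm]
      have ha' : Fin.cons 0 a ≠ (0 : Fin (n + 1) → ℝ) := by
        intro h0
        exact ha (funext fun k => by simpa using congrFun h0 k.succ)
      filter_upwards [h i.succ (Fin.cons 0 a) ha'] with x hx
      simpa [Fin.sum_univ_succ] using hx)
    have hf' : Measurable fun (y : Fin n → Fin (n + 1) → ℝ) (i j : Fin n) => y i j.succ :=
      measurable_pi_lambda _ fun i => hf.comp (measurable_pi_apply i)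
    rw [← Measure.pi_map_pi (fun i => hf.aemeasurable), ae_map_ne_zero_iff hf'.aemeasurable (measurable_matrix_det n)] at ih
    -- expand the determinant along the first row, which is independent of the minors
    have hmp := measurePreserving_piFinSuccAbove ν 0
    let g : (Fin (n + 1) → ℝ) × (Fin n → Fin (n + 1) → ℝ) → ℝ := fun p =>
      ∑ j : Fin (n + 1), (-1) ^ (j : ℕ) * p.1 j *
        (Matrix.of fun (i : Fin n) (k : Fin n) => p.2 i (j.succAbove k)).det
    have hg : Measurable g := by
      refine Finset.measurable_sum _ fun j _ => Measurable.mul ?_ ?_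
      · exact ((measurable_pi_apply j).comp measurable_fst).const_mul _
      · refine (measurable_matrix_det n).comp (measurable_pi_lambda _ fun i => measurable_pi_lambda _ fun k => ?_)
        exact (measurable_pi_apply _).comp ((measurable_pi_apply i).comp measurable_snd)
    have hgN : ∀ N : Fin (n + 1) → Fin (n + 1) → ℝ,
        (Matrix.of N).det = g (MeasurableEquiv.piFinSuccAbove _ 0 N) := by
      intro N
      rw [Matrix.det_succ_row_zero]
      rfl
    have hnull : ∀ᵐ p ∂((ν 0).prod (Measure.pi fun j => ν (Fin.succAbove 0 j))), g p ≠ 0 := by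
      have hS : MeasurableSet {p | g p = 0} := hg (measurableSet_singleton 0)
      rw [ae_iff]
      simp only [not_not]
      rw [Measure.prod_apply_symm hS, lintegral_eq_zero_iff (measurable_measure_prodMk_right hS)]
      filter_upwards [ih] with y hy
      have ha : (fun j : Fin (n + 1) => (-1 : ℝ) ^ (j : ℕ) *
          (Matrix.of fun (i : Fin n) (k : Fin n) => y i (j.succAbove k)).det) ≠ 0 := by
        intro h0
        have := congrFun h0 0
        simp at this
        exact hy this
      have := h 0 _ ha
      rw [ae_iff] at this
      simp only [not_not] at this
      refine Eq.trans ?_ this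
      congr 1
      ext x
      simp only [Set.mem_preimage, Set.mem_ofPred_eq, g]
      rw [iff_iff_eq]
      congr 1
      exact Finset.sum_congr rfl fun j _ => by ring
    rw [← hmp.map_eq, ae_map_ne_zero_iff hmp.measurable.aemeasurable hg] at hnull
    filter_upwards [hnull] with N hN
    rwa [hgN]

/-- If `f` is independent of `g` and `(f, g)` is independent of `h`, then `f` is independent of
`(g, h)`. -/
theorem indepFun_prodMk_of_indepFun {Ω β γ δ : Type*} [MeasurableSpace Ω] [MeasurableSpace β]
    [MeasurableSpace γ] [MeasurableSpace δ] {P : Measure Ω} [IsProbabilityMeasure P]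
    {f : Ω → β} {g : Ω → γ} {h : Ω → δ} (hf : AEMeasurable f P) (hg : AEMeasurable g P)
    (hh : AEMeasurable h P) (hfg : IndepFun f g P) (hfgh : IndepFun (fun ω => (f ω, g ω)) h P) :
    IndepFun f (fun ω => (g ω, h ω)) P := by
  have hgh : IndepFun g h P := hfgh.comp measurable_snd measurable_id
  have : IsProbabilityMeasure (P.map f) := Measure.isProbabilityMeasure_map hf
  have : IsProbabilityMeasure (P.map g) := Measure.isProbabilityMeasure_map hg
  have : IsProbabilityMeasure (P.map h) := Measure.isProbabilityMeasure_map hh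
  rw [indepFun_iff_map_prod_eq_prod_map_map hf (hg.prodMk hh),
    (indepFun_iff_map_prod_eq_prod_map_map hg hh).1 hgh, ← Measure.prodAssoc_prod,
    ← (indepFun_iff_map_prod_eq_prod_map_map hf hg).1 hfg,
    ← (indepFun_iff_map_prod_eq_prod_map_map (hf.prodMk hg) hh).1 hfgh,
    AEMeasurable.map_map_of_aemeasurable MeasurableEquiv.prodAssoc.measurable.aemeasurable
      ((hf.prodMk hg).prodMk hh)]
  rfl

theorem nullSingletonClass_map_mul {Ω : Type*} [MeasurableSpace Ω] {P : Measure Ω} {X : Ω → ℝ}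
    (hX : AEMeasurable X P) [NullSingletonClass (P.map X)] {c : ℝ} (hc : c ≠ 0) :
    NullSingletonClass (P.map fun ω => c * X ω) where
  measure_singleton x := by
    have h := measure_singleton (μ := P.map X) (x / c)
    rw [Measure.map_apply_of_aemeasurable hX (measurableSet_singleton _)] at h
    rw [Measure.map_apply_of_aemeasurable (hX.const_mul c) (measurableSet_singleton _)]
    convert h using 2
    ext ω
    simp only [Set.mem_preimage, Set.mem_singleton_iff]
    rw [eq_div_iff hc, mul_comm]

/-! ### Non-degeneracy of the Brownian bridge -/

theorem sum_range_two_mul {M : Type*} [AddCommMonoid M] (f : ℕ → M) (m : ℕ) :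
    ∑ j ∈ Finset.range (2 * m), f j = ∑ k ∈ Finset.range m, (f (2 * k) + f (2 * k + 1)) := by
  induction m with
  | zero => simp
  | succ m ih =>
    rw [Finset.sum_range_succ, ← ih, show 2 * (m + 1) = 2 * m + 1 + 1 by ring,
      Finset.sum_range_succ, Finset.sum_range_succ, add_assoc]

/-- The second differences `B(t_{2k+2}) - 2 B(t_{2k+1}) + B(t_{2k})` over the grid
`t_j = j / (2q)`. -/
noncomputable def secondDiff (q : ℕ) (b : ℝ≥0 → ℝ) (k : Fin q) : ℝ :=
  (b ((2 * k + 1 + 1 : ℕ) / (2 * q)) - b ((2 * k + 1 : ℕ) / (2 * q))) -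
    (b ((2 * k + 1 : ℕ) / (2 * q)) - b ((2 * k : ℕ) / (2 * q)))

theorem ae_sum_secondDiff_ne_zero {Ω' : Type*} [MeasurableSpace Ω'] {P : Measure Ω'}
    [IsProbabilityMeasure P] {B : ℝ≥0 → Ω' → ℝ} (hB : IsPreBrownianReal B P) {q : ℕ}
    {a : Fin q → ℝ} (ha : a ≠ 0) :
    ∀ᵐ ω ∂P, ∑ k, a k * secondDiff q (fun t => B t ω) k ≠ 0 := by
  obtain ⟨k₀, hk₀⟩ := Function.ne_iff.1 ha
  have hq : (q : ℝ≥0) ≠ 0 := by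
    have := k₀.pos
    positivity
  let t : ℕ → ℝ≥0 := fun j => (j : ℝ≥0) / (2 * q)
  have ht : Monotone t := fun i j hij => by
    simp only [t]
    gcongr
  let a' : ℕ → ℝ := fun k => if h : k < q then a ⟨k, h⟩ else 0
  let c : ℕ → ℝ := fun j => if Even j then -a' (j / 2) else a' (j / 2)
  let D : ℕ → Ω' → ℝ := fun j ω => B (t (j + 1)) ω - B (t j) ω
  have hD : iIndepFun D P := hB.hasIndepIncrements.nat ht
  have hDm : ∀ j, AEMeasurable (D j) P := fun j => (hB.aemeasurable _).sub (hB.aemeasurable _)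
  let f : ℕ → Ω' → ℝ := fun j ω => c j * D j ω
  have hf : iIndepFun f P := hD.comp (fun j x => c j * x) fun j => measurable_const_mul _
  have hfm : ∀ j, AEMeasurable (f j) P := fun j => (hDm j).const_mul _
  have hsum : ∀ ω, ∑ k, a k * secondDiff q (fun t => B t ω) k =
      ∑ j ∈ Finset.range (2 * q), f j ω := by
    intro ω
    rw [sum_range_two_mul, Finset.sum_range]
    refine Finset.sum_congr rfl fun k _ => ?_
    have h1 : c (2 * k) = -a k := by simp [c, a']
    have h2 : c (2 * k + 1) = a k := by
      have : (2 * (k : ℕ) + 1) / 2 = k := by omega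
      simp [c, a', this]
    simp only [f, h1, h2, D, secondDiff, t]
    ring
  let j₀ : ℕ := 2 * k₀ + 1
  have hj₀ : j₀ ∈ Finset.range (2 * q) := by
    have := k₀.2
    simp only [j₀, Finset.mem_range]
    omega
  have hcj : c j₀ ≠ 0 := by
    have : (2 * (k₀ : ℕ) + 1) / 2 = k₀ := by omega
    simpa [c, a', j₀, this] using hk₀
  have hind := hf.indepFun_finsetSum_of_notMem₀ hfm (Finset.notMem_erase j₀ (Finset.range (2 * q)))
  have hlaw : P.map (D j₀) = gaussianReal 0 (nndist (t (j₀ + 1)).1 (t j₀).1) :=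
    (hB.hasLaw_sub _ _).map_eq
  have hvar : nndist (t (j₀ + 1)).1 (t j₀).1 ≠ 0 := by
    rw [Ne, nndist_eq_zero]
    intro h
    have h' : t (j₀ + 1) = t j₀ := NNReal.coe_injective h
    simp only [t] at h'
    rw [div_left_inj' (by positivity)] at h'
    exact absurd (Nat.cast_injective h') (Nat.succ_ne_self _)
  have hatom : NullSingletonClass (P.map (D j₀)) := by
    rw [hlaw]
    exact nullSingletonClass_gaussianReal hvar
  have hatom' : NullSingletonClass (P.map (f j₀)) := nullSingletonClass_map_mul (hDm j₀) hcj
  have hrest : AEMeasurable (∑ j ∈ (Finset.range (2 * q)).erase j₀, f j) P :=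
    Finset.aemeasurable_sum _ fun j _ => hfm j
  have hS : MeasurableSet {p : ℝ × ℝ | p.1 + p.2 = 0} :=
    (measurable_fst.add measurable_snd) (measurableSet_singleton 0)
  have := ae_notMem_of_indepFun hind.symm (hfm j₀) hrest hS (Eventually.of_forall fun ω => by
    refine (Set.countable_singleton (-(∑ j ∈ (Finset.range (2 * q)).erase j₀, f j) ω)).mono ?_
    intro x hx
    exact eq_neg_of_add_eq_zero_left hx)
  filter_upwards [this] with ω hω
  rw [hsum, ← Finset.add_sum_erase _ _ hj₀]
  simpa using hω

theorem continuous_bridge {q : ℕ} (b : Fin q → C(ℝ≥0, ℝ)) (i : Fin q) :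
    Continuous (bridge b i) := by
  unfold bridge
  fun_prop

/-- Second differences over an equally spaced grid annihilate the linear part of the bridge. -/
theorem secondDiff_eq_bridge {q : ℕ} (b : Fin q → C(ℝ≥0, ℝ)) (i k : Fin q) :
    secondDiff q (b i) k =
      (bridge b i ((2 * k + 1 + 1 : ℕ) / (2 * q)) - bridge b i ((2 * k + 1 : ℕ) / (2 * q))) -
      (bridge b i ((2 * k + 1 : ℕ) / (2 * q)) - bridge b i ((2 * k : ℕ) / (2 * q))) := by
  have h : ∀ m : ℕ, Real.toNNReal ((m : ℝ) / (2 * q)) = (m : ℝ≥0) / (2 * q) := by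
    intro m
    ext
    rw [Real.coe_toNNReal _ (by positivity)]
    push_cast
    rfl
  simp only [secondDiff, bridge, h]
  push_cast
  ring

theorem dotProduct_limitV {q : ℕ} (b : Fin q → C(ℝ≥0, ℝ)) (v : Fin q → ℝ) :
    v ⬝ᵥ (limitV b *ᵥ v) = ∫ r in (0 : ℝ)..1, (∑ i, v i * bridge b i r) ^ 2 := by
  have hint : ∀ i j, IntervalIntegrable (fun r => v i * (bridge b i r * bridge b j r * v j))
      volume 0 1 := fun i j => by
    have := continuous_bridge b i
    have := continuous_bridge b j
    exact Continuous.intervalIntegrable (by fun_prop) _ _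
  have hexp : ∀ r, (∑ i, v i * bridge b i r) ^ 2 =
      ∑ i, ∑ j, v i * (bridge b i r * bridge b j r * v j) := by
    intro r
    rw [sq, Finset.sum_mul_sum]
    exact Finset.sum_congr rfl fun i _ => Finset.sum_congr rfl fun j _ => by ring
  simp only [hexp]
  have hint' : ∀ i, IntervalIntegrable
      (fun r => ∑ j, v i * (bridge b i r * bridge b j r * v j)) volume 0 1 := fun i => by
    have := continuous_bridge b
    exact Continuous.intervalIntegrable (by fun_prop) _ _
  rw [intervalIntegral.integral_finsetSum fun i _ => hint' i]
  simp only [dotProduct, Matrix.mulVec, limitV, Matrix.of_apply]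
  refine Finset.sum_congr rfl fun i _ => ?_
  rw [intervalIntegral.integral_finsetSum fun j _ => hint i j, Finset.mul_sum]
  refine Finset.sum_congr rfl fun j _ => ?_
  rw [intervalIntegral.integral_const_mul, intervalIntegral.integral_mul_const]

/-- `V_q` is the Gram matrix of the bridges, so it is positive definite as soon as these are
linearly independent, which the second differences detect. -/
theorem posDef_limitV {q : ℕ} {b : Fin q → C(ℝ≥0, ℝ)}
    (hdet : (Matrix.of fun i => secondDiff q (b i)).det ≠ 0) : (limitV b).PosDef := by
  refine Matrix.PosDef.of_dotProduct_mulVec_pos ?_ fun v hv => ?_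
  · ext i j
    simp [limitV, mul_comm]
  simp only [star_trivial]
  rw [dotProduct_limitV]
  have hcont : Continuous fun r => (∑ i, v i * bridge b i r) ^ 2 := by
    have := continuous_bridge b
    fun_prop
  refine (intervalIntegral.integral_nonneg zero_le_one fun r _ => sq_nonneg _).lt_of_ne' ?_
  intro h0
  have hz : ∀ r ∈ Set.Icc (0 : ℝ) 1, ∑ i, v i * bridge b i r = 0 := by
    by_contra! hcon
    obtain ⟨r, hr, hne⟩ := hcon
    have := intervalIntegral.integral_pos zero_lt_one hcont.continuousOn
      (fun r _ => sq_nonneg _) ⟨r, hr, by positivity⟩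
    exact this.ne' h0
  refine hdet (Matrix.exists_vecMul_eq_zero_iff.1 ⟨v, hv, ?_⟩)
  ext k
  have hq : (0 : ℝ) < q := Nat.cast_pos.2 k.pos
  have hmem : ∀ m : ℕ, m ≤ 2 * q → ((m : ℝ) / (2 * q)) ∈ Set.Icc (0 : ℝ) 1 := fun m hm =>
    ⟨by positivity, (div_le_one (by positivity)).2 (by exact_mod_cast hm)⟩
  have hk := k.2
  have e1 := hz _ (hmem (2 * k + 1 + 1) (by omega))
  have e2 := hz _ (hmem (2 * k + 1) (by omega))
  have e3 := hz _ (hmem (2 * k) (by omega))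
  simp only [Matrix.vecMul, dotProduct, Matrix.of_apply, Pi.zero_apply, secondDiff_eq_bridge,
    mul_sub, Finset.sum_sub_distrib, e1, e2, e3]
  ring

theorem ae_posDef_limitV {Ω' : Type*} [MeasurableSpace Ω'] {P : Measure Ω'}
    [IsProbabilityMeasure P] {q : ℕ} {W : Fin q → Ω' → C(ℝ≥0, ℝ)} (hW : IsBrownianVector W P) :
    ∀ᵐ ω ∂P, (limitV fun i => W i ω).PosDef := by
  have hm : ∀ t, Measurable fun b : ℝ≥0 → ℝ => b t := fun t => measurable_pi_apply t
  have hsd : Measurable (secondDiff q) :=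
    measurable_pi_lambda _ fun k => ((hm _).sub (hm _)).sub ((hm _).sub (hm _))
  have hind := hW.indep.comp (fun _ => secondDiff q) fun _ => hsd
  have hrow : ∀ i, AEMeasurable (fun ω => secondDiff q (W i ω)) P := fun i =>
    aemeasurable_pi_lambda _ fun k => by
      have := (hW.isBrownianReal i).toIsPreBrownianReal.aemeasurable
      exact ((this _).sub (this _)).sub ((this _).sub (this _))
  have hlaw := iIndepFun.map_fun_eq_pi_map hrow hind
  have hprob : ∀ i, IsProbabilityMeasure (P.map fun ω => secondDiff q (W i ω)) := fun i =>
    Measure.isProbabilityMeasure_map (hrow i)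
  have hdet := ae_det_ne_zero_pi q (fun i => P.map fun ω => secondDiff q (W i ω)) (by
    intro i a ha
    have hmeas : Measurable fun x : Fin q → ℝ => ∑ k, a k * x k :=
      Finset.measurable_sum _ fun k _ => (measurable_pi_apply k).const_mul _
    rw [ae_map_ne_zero_iff (hrow i) hmeas]
    exact ae_sum_secondDiff_ne_zero (hW.isBrownianReal i).toIsPreBrownianReal ha)
  rw [← hlaw, ae_map_ne_zero_iff (aemeasurable_pi_lambda _ hrow) (measurable_matrix_det q)] at hdet
  filter_upwards [hdet] with ω hω
  exact posDef_limitV hω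

/-! ### The law of `U_q` has no atoms -/

theorem measurable_matrix_inv_apply {q : ℕ} (i j : Fin q) :
    Measurable fun N : Fin q → Fin q → ℝ => (Matrix.of N)⁻¹ i j := by
  have h : Continuous fun N : Fin q → Fin q → ℝ => (Matrix.of N).adjugate i j :=
    (Continuous.matrix_adjugate (A := fun N : Fin q → Fin q → ℝ => Matrix.of N)
      continuous_id).matrix_elem i j
  simp only [Matrix.inv_def, Ring.inverse_eq_inv', Matrix.smul_apply, smul_eq_mul]
  exact (measurable_matrix_det q).inv.mul h.measurable

theorem measurable_inv_quadForm {q : ℕ} :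
    Measurable fun p : (Fin q → ℝ) × (Fin q → Fin q → ℝ) =>
      p.1 ⬝ᵥ ((Matrix.of p.2)⁻¹ *ᵥ p.1) := by
  simp only [dotProduct, Matrix.mulVec]
  refine Finset.measurable_sum _ fun i _ => Measurable.mul ?_
    (Finset.measurable_sum _ fun j _ => Measurable.mul ?_ ?_)
  · exact (measurable_pi_apply i).comp measurable_fst
  · exact (measurable_matrix_inv_apply i j).comp measurable_snd
  · exact (measurable_pi_apply j).comp measurable_fst

theorem countable_quadForm_eq {q : ℕ} (A : Matrix (Fin q) (Fin q) ℝ) (i₀ : Fin q)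
    (hA : A i₀ i₀ ≠ 0) (w : Fin q → ℝ) (c : ℝ) :
    {x : ℝ | (w + x • Pi.single i₀ 1) ⬝ᵥ (A *ᵥ (w + x • Pi.single i₀ 1)) = c}.Countable := by
  let e : Fin q → ℝ := Pi.single i₀ 1
  let p : Polynomial ℝ := Polynomial.C (A i₀ i₀) * Polynomial.X ^ 2 +
    Polynomial.C (w ⬝ᵥ (A *ᵥ e) + e ⬝ᵥ (A *ᵥ w)) * Polynomial.X +
    Polynomial.C (w ⬝ᵥ (A *ᵥ w) - c)
  have hp : p ≠ 0 := fun h0 => hA (by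
    have := congrArg (fun r => Polynomial.coeff r 2) h0
    simpa [p, Polynomial.coeff_X, Polynomial.coeff_C] using this)
  refine ((Polynomial.finite_setOfPred_isRoot hp).subset fun x hx => ?_).countable
  have he : e ⬝ᵥ (A *ᵥ e) = A i₀ i₀ := by simp [e, Matrix.mulVec_single]
  have hx' : (w + x • e) ⬝ᵥ (A *ᵥ (w + x • e)) = c := hx
  simp only [Matrix.mulVec_add, Matrix.mulVec_smul, add_dotProduct, dotProduct_add,
    smul_dotProduct, dotProduct_smul, smul_eq_mul, he] at hx'
  show p.eval x = 0
  simp only [p, Polynomial.eval_add, Polynomial.eval_mul, Polynomial.eval_C, Polynomial.eval_pow,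
    Polynomial.eval_X]
  linear_combination hx'

theorem tendsto_riemannSum {f : ℝ → ℝ} (hf : Continuous f) :
    Tendsto (fun n : ℕ => (n : ℝ)⁻¹ * ∑ k ∈ Finset.range n, f (k / n)) atTop
      (𝓝 (∫ r in (0 : ℝ)..1, f r)) := by
  rw [← integral_unitInterval]
  obtain ⟨C, hC⟩ := isCompact_Icc.exists_bound_of_continuousOn (f := f) (s := Set.Icc 0 1)
    hf.continuousOn
  have h : Tendsto (fun n : ℕ => ∫ r : unitInterval, f (⌊(r : ℝ) * n⌋₊ / n)) atTop
      (𝓝 (∫ r : unitInterval, f r)) := by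
    refine tendsto_integral_of_dominated_convergence (fun _ => C) (fun n =>
      (isCadlag_floor n fun k => f (k / n)).aestronglyMeasurable) (integrable_const _)
      (fun n => Eventually.of_forall fun r => hC _ ⟨by positivity, ?_⟩)
      (Eventually.of_forall fun r => ?_)
    · refine div_le_one_of_le₀ ?_ (Nat.cast_nonneg n)
      exact (Nat.floor_le (mul_nonneg r.2.1 (Nat.cast_nonneg n))).trans
        (mul_le_of_le_one_left (Nat.cast_nonneg n) r.2.2)
    · exact (hf.tendsto _).comp
        ((tendsto_nat_floor_mul_div_atTop r.2.1).comp tendsto_natCast_atTop_atTop)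
  refine h.congr' ?_
  filter_upwards [eventually_gt_atTop 0] with n hn
  exact integral_floor n hn fun k => f (k / n)

/-- The rational points `k / n` of `[0, 1]`, indexed by pairs `(k, n)`. -/
noncomputable def unitGrid (p : ℕ × ℕ) : ℝ≥0 := min (p.1 / p.2) 1

/-- The end value of a Brownian motion is independent of its bridge. -/
theorem indepFun_one_bridge {Ω' : Type*} [MeasurableSpace Ω'] {P : Measure Ω'}
    [IsProbabilityMeasure P] {B : ℝ≥0 → Ω' → ℝ} (hB : IsPreBrownianReal B P) :
    IndepFun (B 1) (fun ω (p : ℕ × ℕ) => B (unitGrid p) ω - unitGrid p * B 1 ω) P := by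
  have hgp : IsGaussianProcess (Sum.elim (fun _ : Unit => B 1)
      (fun (p : ℕ × ℕ) ω => B (unitGrid p) ω - unitGrid p * B 1 ω)) P := by
    classical
    refine hB.isGaussianProcess.of_isGaussianProcess ?_
    rintro (_ | p)
    · exact ⟨{1}, ContinuousLinearMap.proj (R := ℝ) (φ := fun _ => ℝ) ⟨1, by simp⟩,
        fun ω => rfl⟩
    · exact ⟨{1, unitGrid p}, ContinuousLinearMap.proj (R := ℝ) (φ := fun _ => ℝ)
        ⟨unitGrid p, by simp⟩ - (unitGrid p : ℝ) •
          ContinuousLinearMap.proj (R := ℝ) (φ := fun _ => ℝ) ⟨1, by simp⟩, fun ω => by simp⟩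
  have hind := hgp.indepFun_of_covariance_eq_zero (fun _ => hB.aemeasurable 1)
    (fun p => (hB.aemeasurable _).sub ((hB.aemeasurable 1).const_mul _)) (by
      intro _ p
      have hL : ∀ t, MemLp (B t) 2 P := fun t =>
        (hB.isGaussianProcess.hasGaussianLaw_eval t).memLp_two
      rw [covariance_fun_sub_right (hL 1) (hL _) ((hL 1).const_mul _),
        covariance_const_mul_right, hB.covariance_eval, hB.covariance_eval]
      have : min 1 (unitGrid p) = unitGrid p := min_eq_right (min_le_right _ _)
      simp [this])
  exact hind.comp (measurable_pi_apply ()) measurable_id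

/-- `U_q` is a quadratic polynomial in the end value of one of the Brownian motions, with nonzero
leading coefficient, and that end value is independent of the coefficients. -/
theorem ae_limitU_ne {Ω' : Type*} [MeasurableSpace Ω'] {P : Measure Ω'} [IsProbabilityMeasure P]
    {q : ℕ} (i₀ : Fin q) {W : Fin q → Ω' → C(ℝ≥0, ℝ)} (hW : IsBrownianVector W P) (c : ℝ) :
    ∀ᵐ ω ∂P, limitU (fun i => W i ω) ≠ c := by
  have hB : ∀ i, IsPreBrownianReal (fun t ω => W i ω t) P := fun i =>
    (hW.isBrownianReal i).toIsPreBrownianReal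
  have hBm : ∀ i t, AEMeasurable (fun ω => W i ω t) P := fun i t => (hB i).aemeasurable t
  let z : Ω' → ℝ := fun ω => W i₀ ω 1
  let g : Ω' → ℕ × ℕ → ℝ := fun ω p => W i₀ ω (unitGrid p) - unitGrid p * W i₀ ω 1
  let T : Finset (Fin q) := Finset.univ.erase i₀
  let h : Ω' → T → ℕ × ℕ → ℝ := fun ω i p => W i ω (unitGrid p)
  have hgrid11 : unitGrid (1, 1) = 1 := by simp [unitGrid]
  have hgm : AEMeasurable g P := aemeasurable_pi_lambda _ fun p =>
    (hBm i₀ _).sub ((hBm i₀ 1).const_mul _)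
  have hhm : AEMeasurable h P :=
    aemeasurable_pi_lambda _ fun i => aemeasurable_pi_lambda _ fun p => hBm _ _
  have hzg : IndepFun z g P := indepFun_one_bridge (hB i₀)
  have hzgh : IndepFun (fun ω => (z ω, g ω)) h P := by
    have h1 : iIndepFun (fun i ω (p : ℕ × ℕ) => W i ω (unitGrid p)) P :=
      hW.indep.comp (fun _ (x : ℝ≥0 → ℝ) (p : ℕ × ℕ) => x (unitGrid p)) fun _ =>
        measurable_pi_lambda _ fun p => measurable_pi_apply _
    have h2 := h1.indepFun_finset₀ {i₀} T
      (by simp [T]) fun i => aemeasurable_pi_lambda _ fun p => hBm _ _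
    let i₁ : ({i₀} : Finset (Fin q)) := ⟨i₀, by simp⟩
    let φ : (↥({i₀} : Finset (Fin q)) → ℕ × ℕ → ℝ) → ℝ × (ℕ × ℕ → ℝ) := fun y =>
      (y i₁ (1, 1), fun p => y i₁ p - (unitGrid p : ℝ) * y i₁ (1, 1))
    have hφ : Measurable φ := by fun_prop
    have h3 := h2.comp hφ measurable_id
    simp only [Function.comp_def, φ, i₁, hgrid11] at h3
    exact h3
  have hind := indepFun_prodMk_of_indepFun (hBm i₀ 1) hgm hhm hzg hzgh
  -- recover the bridges, the matrix `V_q` and the other end values from `(g, h)`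
  let Φ : (ℕ × ℕ → ℝ) × (T → ℕ × ℕ → ℝ) → Fin q → ℕ × ℕ → ℝ := fun y i p =>
    if hi : i = i₀ then y.1 p else
      y.2 ⟨i, by simp [T, hi]⟩ p - unitGrid p * y.2 ⟨i, by simp [T, hi]⟩ (1, 1)
  have hΦ : ∀ i p, Measurable fun y => Φ y i p := by
    intro i p
    by_cases hi : i = i₀
    · simp only [Φ, hi, dif_pos]
      fun_prop
    · simp only [Φ, hi, dif_neg, not_false_eq_true]
      fun_prop
  let Vf : (ℕ × ℕ → ℝ) × (T → ℕ × ℕ → ℝ) → Fin q → Fin q → ℝ := fun y i j =>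
    limsup (fun n : ℕ => (n : ℝ)⁻¹ * ∑ k ∈ Finset.range n, Φ y i (k, n) * Φ y j (k, n)) atTop
  have hVf : Measurable Vf := measurable_pi_lambda _ fun i => measurable_pi_lambda _ fun j =>
    Measurable.limsup fun n => Measurable.const_mul
      (Finset.measurable_sum _ fun k _ => (hΦ i _).mul (hΦ j _)) _
  let wf : (ℕ × ℕ → ℝ) × (T → ℕ × ℕ → ℝ) → Fin q → ℝ := fun y j =>
    if hj : j = i₀ then 0 else y.2 ⟨j, by simp [T, hj]⟩ (1, 1)
  have hwf : Measurable wf := by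
    refine measurable_pi_lambda _ fun j => ?_
    by_cases hj : j = i₀
    · simp only [wf, hj, dif_pos]
      fun_prop
    · simp only [wf, hj, dif_neg, not_false_eq_true]
      fun_prop
  let S : Set (ℝ × (ℕ × ℕ → ℝ) × (T → ℕ × ℕ → ℝ)) := {p | (wf p.2 + p.1 • Pi.single i₀ 1) ⬝ᵥ
    ((Matrix.of (Vf p.2))⁻¹ *ᵥ (wf p.2 + p.1 • Pi.single i₀ 1)) = c}
  have hS : MeasurableSet S := by
    have h1 : Measurable fun p : ℝ × (ℕ × ℕ → ℝ) × (T → ℕ × ℕ → ℝ) => wf p.2 + p.1 • (Pi.single i₀ 1 : Fin q → ℝ) :=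
      (hwf.comp measurable_snd).add (measurable_fst.smul_const _)
    exact (measurable_inv_quadForm.comp (h1.prodMk (hVf.comp measurable_snd)))
      (measurableSet_singleton c)
  have hV : ∀ ω, Matrix.of (Vf (g ω, h ω)) = limitV fun i => W i ω := by
    intro ω
    ext i j
    simp only [Matrix.of_apply, limitV, Vf]
    refine Tendsto.limsup_eq ?_
    have hc := continuous_bridge fun i => W i ω
    refine (tendsto_riemannSum ((hc i).mul (hc j))).congr fun n => ?_
    congr 1
    refine Finset.sum_congr rfl fun k hk => ?_
    have hkn : ∀ i, Φ (g ω, h ω) i (k, n) = bridge (fun i => W i ω) i (k / n) := by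
      intro i
      have hlt := Finset.mem_range.1 hk
      have hgr : unitGrid (k, n) = (k : ℝ≥0) / n := by
        refine min_eq_left (div_le_one_of_le₀ ?_ zero_le)
        exact_mod_cast hlt.le
      have hr : Real.toNNReal ((k : ℝ) / n) = (k : ℝ≥0) / n := by
        rw [Real.toNNReal_div (Nat.cast_nonneg k), Real.toNNReal_natCast, Real.toNNReal_natCast]
      by_cases hi : i = i₀
      · subst hi
        simp [Φ, g, bridge, hgr, hr]
      · simp [Φ, h, hi, bridge, hgr, hr, hgrid11]
    rw [hkn, hkn]
    rfl
  have hw : ∀ ω, wf (g ω, h ω) + z ω • Pi.single i₀ 1 = fun i => W i ω 1 := by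
    intro ω
    ext j
    by_cases hj : j = i₀
    · subst hj
      simp [wf, z]
    · simp [wf, hj, h, hgrid11]
  have hatom : NullSingletonClass (P.map z) := by
    rw [show P.map z = gaussianReal 0 1 from ((hB i₀).hasLaw_eval 1).map_eq]
    exact nullSingletonClass_gaussianReal one_ne_zero
  have := ae_notMem_of_indepFun hind (hBm i₀ 1) (hgm.prodMk hhm) hS (by
    filter_upwards [ae_posDef_limitV hW] with ω hω
    have hA := hω.inv.diag_pos (i := i₀)
    rw [← hV] at hA
    exact countable_quadForm_eq _ i₀ hA.ne' (wf (g ω, h ω)) c)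
  filter_upwards [this] with ω hω hU
  refine hω ?_
  show (wf (g ω, h ω) + z ω • Pi.single i₀ 1) ⬝ᵥ ((Matrix.of (Vf (g ω, h ω)))⁻¹ *ᵥ
    (wf (g ω, h ω) + z ω • Pi.single i₀ 1)) = c
  rw [hV, hw]
  exact hU

/-! ### Comparison of the statistic with the partial sum process -/

theorem partialSumPath_one {q : ℕ} (n : ℕ) (v : ℕ → EuclideanSpace ℝ (Fin q)) :
    partialSumPath n v 1 = (√(n : ℝ))⁻¹ • ∑ t ∈ Finset.Icc 1 n, v t := by
  simp [partialSumPath]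

/-- The pair `(√n (θ̂_n - θ), W_n)`, of which the self-normalized statistic is a function. -/
noncomputable def scaledPair {q : ℕ} (θhat : ℕ → EuclideanSpace ℝ (Fin q))
    (θ : EuclideanSpace ℝ (Fin q)) (n : ℕ) :
    EuclideanSpace ℝ (Fin q) × (Fin q → Fin q → ℝ) :=
  (√(n : ℝ) • (θhat n - θ), normMatrix θhat n)

/-- The error `t (θ̂_t - θ̄) - ∑_{s ≤ t} v_s` of the linear approximation of the scaled estimates. -/
noncomputable def expansionError {q : ℕ} (θhat : ℕ → EuclideanSpace ℝ (Fin q))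
    (θbar : EuclideanSpace ℝ (Fin q)) (v : ℕ → EuclideanSpace ℝ (Fin q)) (t : ℕ) :
    EuclideanSpace ℝ (Fin q) :=
  (t : ℝ) • (θhat t - θbar) - ∑ s ∈ Finset.Icc 1 t, v s

theorem norm_scaledPair_fst_sub_le {q : ℕ} (θhat : ℕ → EuclideanSpace ℝ (Fin q))
    (θ θbar : EuclideanSpace ℝ (Fin q)) (v : ℕ → EuclideanSpace ℝ (Fin q)) {n : ℕ} (hn : 0 < n) :
    ‖(scaledPair θhat θ n).1 - (endpointGram (partialSumPath n v)).1‖ ≤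
      ‖(√(n : ℝ))⁻¹ • expansionError θhat θbar v n‖ + √(n : ℝ) * ‖θ - θbar‖ := by
  have hs : (√(n : ℝ))⁻¹ * n = √(n : ℝ) := by
    have h0 : √(n : ℝ) ≠ 0 := by positivity
    field_simp
    exact (Real.sq_sqrt (Nat.cast_nonneg n)).symm
  have h : (scaledPair θhat θ n).1 - (endpointGram (partialSumPath n v)).1 =
      (√(n : ℝ))⁻¹ • expansionError θhat θbar v n - √(n : ℝ) • (θ - θbar) := by
    simp only [scaledPair, endpointGram, partialSumPath_one, expansionError]
    rw [smul_sub (√(n : ℝ))⁻¹, smul_smul, hs]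
    module
  rw [h]
  refine (norm_sub_le _ _).trans (add_le_add le_rfl (le_of_eq ?_))
  rw [norm_smul, Real.norm_of_nonneg (Real.sqrt_nonneg _)]

/-- The step path `r ↦ n^{-1/2} k (θ̂_k - θ̂_n)` with `k = ⌊r n⌋`, whose Gram matrix is `W_n`. -/
noncomputable def estimatePath {q : ℕ} (θhat : ℕ → EuclideanSpace ℝ (Fin q)) (n : ℕ) (i : Fin q)
    (r : unitInterval) : ℝ :=
  (√(n : ℝ))⁻¹ * (⌊(r : ℝ) * n⌋₊ * (θhat ⌊(r : ℝ) * n⌋₊ i - θhat n i))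

theorem isCadlag_estimatePath {q : ℕ} (θhat : ℕ → EuclideanSpace ℝ (Fin q)) (n : ℕ) (i : Fin q) :
    IsCadlag (estimatePath θhat n i) :=
  isCadlag_floor n fun k => (√(n : ℝ))⁻¹ * (k * (θhat k i - θhat n i))

theorem integral_estimatePath {q : ℕ} (θhat : ℕ → EuclideanSpace ℝ (Fin q)) {n : ℕ} (hn : 0 < n)
    (i j : Fin q) :
    ∫ r, estimatePath θhat n i r * estimatePath θhat n j r = normMatrix θhat n i j := by
  have hn' : (0 : ℝ) < n := Nat.cast_pos.2 hn
  have hs : (√(n : ℝ))⁻¹ * (√(n : ℝ))⁻¹ = (n : ℝ)⁻¹ := by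
    rw [← mul_inv, Real.mul_self_sqrt hn'.le]
  have h := integral_floor n hn fun k => ((√(n : ℝ))⁻¹ * (k * (θhat k i - θhat n i))) *
    ((√(n : ℝ))⁻¹ * (k * (θhat k j - θhat n j)))
  refine h.trans ?_
  have hterm : ∀ k : ℕ, ((√(n : ℝ))⁻¹ * (k * (θhat k i - θhat n i))) *
      ((√(n : ℝ))⁻¹ * (k * (θhat k j - θhat n j))) =
      (n : ℝ)⁻¹ * ((k : ℝ) ^ 2 * ((θhat k i - θhat n i) * (θhat k j - θhat n j))) := fun k => by
    rw [← hs]; ring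
  simp only [hterm, normMatrix, Matrix.of_apply]
  -- the terms `k = 0` and `k = n` vanish
  have hIcc : ∑ k ∈ Finset.range n,
        (k : ℝ) ^ 2 * ((θhat k i - θhat n i) * (θhat k j - θhat n j)) =
      ∑ k ∈ Finset.Icc 1 n, (k : ℝ) ^ 2 * ((θhat k i - θhat n i) * (θhat k j - θhat n j)) := by
    have h1 := Finset.sum_range_succ
      (fun k : ℕ => (k : ℝ) ^ 2 * ((θhat k i - θhat n i) * (θhat k j - θhat n j))) n
    simp only [sub_self, mul_zero, add_zero] at h1
    rw [← h1]
    refine (Finset.sum_subset (fun k hk => ?_) fun k hk hk' => ?_).symm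
    · simp only [Finset.mem_Icc, Finset.mem_range] at hk ⊢
      omega
    · have : k = 0 := by
        simp only [Finset.mem_Icc, Finset.mem_range] at hk hk'
        omega
      simp [this]
  rw [← Finset.mul_sum, hIcc, ← mul_assoc]
  congr 1
  rw [sq, mul_inv]

/-- The mean square distance between the path of the estimates and the tied-down partial sum
path. -/
theorem integral_sq_estimatePath_sub_le {q : ℕ} (θhat : ℕ → EuclideanSpace ℝ (Fin q))
    (θbar : EuclideanSpace ℝ (Fin q)) (v : ℕ → EuclideanSpace ℝ (Fin q)) {n : ℕ} (hn : 0 < n)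
    (i : Fin q) :
    ∫ r, (estimatePath θhat n i r - tiedDown (partialSumPath n v).toFun i r) ^ 2 ≤
      3 * (((n : ℝ) ^ 2)⁻¹ * ∑ t ∈ Finset.Icc 1 n, ‖expansionError θhat θbar v t‖ ^ 2 +
        ‖(√(n : ℝ))⁻¹ • expansionError θhat θbar v n‖ ^ 2 +
        ((n : ℝ) ^ 2)⁻¹ * ‖partialSumPath n v 1‖ ^ 2) := by
  have hn' : (0 : ℝ) < n := Nat.cast_pos.2 hn
  set e := expansionError θhat θbar v with he
  set s : ℝ := (√(n : ℝ))⁻¹ with hs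
  have hss : s ^ 2 = (n : ℝ)⁻¹ := by
    rw [hs, inv_pow, Real.sq_sqrt hn'.le]
  have hcoord : ∀ (x : EuclideanSpace ℝ (Fin q)), x i ^ 2 ≤ ‖x‖ ^ 2 := fun x => by
    rw [← sq_abs]
    exact pow_le_pow_left₀ (abs_nonneg _) (PiLp.norm_apply_le x i) 2
  set c : ℝ := ‖s • e n‖ ^ 2 + ((n : ℝ) ^ 2)⁻¹ * ‖partialSumPath n v 1‖ ^ 2 with hc
  let g : ℕ → ℝ := fun k => 3 * ((n : ℝ)⁻¹ * ‖e k‖ ^ 2 + c)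
  have hbound : ∀ r : unitInterval,
      (estimatePath θhat n i r - tiedDown (partialSumPath n v).toFun i r) ^ 2 ≤
        g ⌊(r : ℝ) * n⌋₊ := by
    intro r
    set k := ⌊(r : ℝ) * n⌋₊ with hk
    have hk1 : (k : ℝ) ≤ r * n := Nat.floor_le (mul_nonneg r.2.1 hn'.le)
    have hk2 : (r : ℝ) * n < k + 1 := Nat.lt_floor_add_one _
    have hrn : (r : ℝ) * n ≤ n := mul_le_of_le_one_left hn'.le r.2.2
    have hek : (k : ℝ) * (θhat k i - θbar i) = e k i + (∑ t ∈ Finset.Icc 1 k, v t) i := by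
      simp [he, expansionError]
    have hen : (n : ℝ) * (θhat n i - θbar i) = e n i + (∑ t ∈ Finset.Icc 1 n, v t) i := by
      simp [he, expansionError]
    have hS1 : partialSumPath n v 1 i = s * (∑ t ∈ Finset.Icc 1 n, v t) i := by
      rw [partialSumPath_one]; rfl
    have hSr : (partialSumPath n v).toFun r i = s * (∑ t ∈ Finset.Icc 1 k, v t) i := rfl
    have hdec : estimatePath θhat n i r - tiedDown (partialSumPath n v).toFun i r =
        s * e k i - (k / n) * (s * e n i) + (r - k / n) * partialSumPath n v 1 i := by
      have h1 : estimatePath θhat n i r = s * ((k : ℝ) * (θhat k i - θbar i) -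
          (k / n) * ((n : ℝ) * (θhat n i - θbar i))) := by
        simp only [estimatePath, ← hk, ← hs]
        field_simp
        ring
      rw [h1, hek, hen, tiedDown, hSr, hS1]
      ring
    have hkn : (k / n : ℝ) ^ 2 ≤ 1 := by
      refine pow_le_one₀ (by positivity) ((div_le_one hn').2 (hk1.trans hrn))
    have hrk : ((r : ℝ) - k / n) ^ 2 ≤ ((n : ℝ) ^ 2)⁻¹ := by
      rw [← inv_pow]
      refine pow_le_pow_left₀ (sub_nonneg.2 ((div_le_iff₀ hn').2 hk1)) ?_ 2
      rw [sub_le_iff_le_add, ← sub_nonneg]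
      have : (n : ℝ)⁻¹ + k / n - r = (k + 1 - r * n) / n := by
        field_simp
        ring
      rw [this]
      exact div_nonneg (by linarith) hn'.le
    have h3 : ∀ a b d : ℝ, (a - b + d) ^ 2 ≤ 3 * (a ^ 2 + (b ^ 2 + d ^ 2)) := fun a b d => by
      nlinarith [sq_nonneg (a + b), sq_nonneg (a - d), sq_nonneg (b + d)]
    rw [hdec]
    refine (h3 _ _ _).trans ?_
    simp only [g, hc]
    refine mul_le_mul_of_nonneg_left (add_le_add ?_ (add_le_add ?_ ?_)) (by norm_num)
    · rw [mul_pow, hss]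
      exact mul_le_mul_of_nonneg_left (hcoord _) (by positivity)
    · rw [mul_pow]
      calc (k / n : ℝ) ^ 2 * (s * e n i) ^ 2 ≤ 1 * (s * e n i) ^ 2 :=
            mul_le_mul_of_nonneg_right hkn (sq_nonneg _)
        _ ≤ ‖s • e n‖ ^ 2 := by rw [one_mul]; exact hcoord (s • e n)
    · rw [mul_pow]
      exact mul_le_mul hrk (hcoord _) (sq_nonneg _) (by positivity)
  have hcad : IsCadlag fun r : unitInterval =>
      (estimatePath θhat n i r - tiedDown (partialSumPath n v).toFun i r) ^ 2 :=
    ((isCadlag_estimatePath θhat n i).sub ((partialSumPath n v).isCadlag.tiedDown i)).comp_continuous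
      (continuous_pow 2)
  refine (integral_mono hcad.integrable (isCadlag_floor n g).integrable hbound).trans ?_
  rw [integral_floor n hn g]
  simp only [g]
  rw [← Finset.mul_sum, Finset.sum_add_distrib, Finset.sum_const, Finset.card_range, nsmul_eq_mul,
    ← Finset.mul_sum]
  have he0 : e 0 = 0 := by simp [he, expansionError]
  have hsum : ∑ k ∈ Finset.range n, ‖e k‖ ^ 2 ≤ ∑ t ∈ Finset.Icc 1 n, ‖e t‖ ^ 2 := by
    calc ∑ k ∈ Finset.range n, ‖e k‖ ^ 2 ≤ ∑ k ∈ insert 0 (Finset.Icc 1 n), ‖e k‖ ^ 2 := by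
          refine Finset.sum_le_sum_of_subset_of_nonneg (fun k hk => ?_) fun _ _ _ => sq_nonneg _
          simp only [Finset.mem_insert, Finset.mem_Icc, Finset.mem_range] at hk ⊢
          omega
      _ = ∑ t ∈ Finset.Icc 1 n, ‖e t‖ ^ 2 := by
          rw [Finset.sum_insert (by simp), he0]
          simp
  have h1 : (n : ℝ)⁻¹ * (3 * ((n : ℝ)⁻¹ * ∑ k ∈ Finset.range n, ‖e k‖ ^ 2 + n * c)) =
      3 * (((n : ℝ) ^ 2)⁻¹ * ∑ k ∈ Finset.range n, ‖e k‖ ^ 2 + c) := by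
    field_simp
  rw [h1, hc, ← add_assoc]
  gcongr

theorem integral_sq_tiedDown_nonneg {q : ℕ} (x : SkorokhodSpace (EuclideanSpace ℝ (Fin q)))
    (i : Fin q) : 0 ≤ (endpointGram x).2 i i :=
  integral_nonneg fun _ => mul_self_nonneg _

/-- A bound for the difference of two Gram matrices in terms of one of them and the mean square
distance of the functions. -/
theorem abs_integral_mul_sub_le {y y' x x' : unitInterval → ℝ} (hy : IsCadlag y)
    (hy' : IsCadlag y') (hx : IsCadlag x) (hx' : IsCadlag x') {η : ℝ} (hη : 0 < η) :
    |(∫ r, y r * y' r) - ∫ r, x r * x' r| ≤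
      η / 2 * ((∫ r, x r * x r) + ∫ r, x' r * x' r) +
      (η⁻¹ + 1) / 2 * ((∫ r, (y r - x r) ^ 2) + ∫ r, (y' r - x' r) ^ 2) := by
  have hsq : Continuous fun z : ℝ => z ^ 2 := continuous_pow 2
  have i1 := (hx.mul hx).integrable
  have i2 := (hx'.mul hx').integrable
  have i3 := ((hy.sub hx).comp_continuous hsq).integrable
  have i4 := ((hy'.sub hx').comp_continuous hsq).integrable
  have i12 : Integrable (fun r => η / 2 * (x r * x r + x' r * x' r)) volume :=
    (i1.add i2).const_mul _
  have i34 : Integrable (fun r => (η⁻¹ + 1) / 2 * ((y r - x r) ^ 2 + (y' r - x' r) ^ 2)) volume :=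
    (i3.add i4).const_mul _
  rw [← integral_sub (hy.mul hy').integrable (hx.mul hx').integrable, ← integral_add i1 i2,
    ← integral_add i3 i4, ← integral_const_mul, ← integral_const_mul,
    ← integral_add i12 i34, ← Real.norm_eq_abs]
  refine norm_integral_le_of_norm_le (i12.add i34) (Eventually.of_forall fun r => ?_)
  simp only [Real.norm_eq_abs]
  set a := x r
  set b := x' r
  set c := y r - a with hc
  set d := y' r - b with hd
  have hya : y r = a + c := by rw [hc]; ring
  have hyb : y' r = b + d := by rw [hd]; ring
  rw [hya, hyb]
  have key : ∀ u w : ℝ, |u * w| ≤ η / 2 * (u * u) + η⁻¹ / 2 * w ^ 2 := by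
    intro u w
    have h := two_mul_le_add_sq (√η * |u|) ((√η)⁻¹ * |w|)
    have h0 : √η ≠ 0 := (Real.sqrt_pos.2 hη).ne'
    have e1 : 2 * (√η * |u|) * ((√η)⁻¹ * |w|) = 2 * |u * w| := by
      rw [abs_mul]; field_simp
    rw [e1, mul_pow, mul_pow, inv_pow, Real.sq_sqrt hη.le, sq_abs, sq_abs] at h
    nlinarith
  have k1 := key a d
  have k2 := key b c
  have k3 : |c * d| ≤ (c ^ 2 + d ^ 2) / 2 := by
    have := two_mul_le_add_sq |c| |d|
    rw [sq_abs, sq_abs, mul_assoc, ← abs_mul] at this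
    linarith
  calc |(a + c) * (b + d) - a * b| = |a * d + b * c + c * d| := by congr 1; ring
    _ ≤ |a * d| + |b * c| + |c * d| := abs_add_three _ _ _
    _ ≤ _ := by nlinarith

/-- On the event that the limit functional of the partial sum path is bounded by `M`, the pair
`(√n (θ̂_n - θ), W_n)` is close to that functional as soon as the errors are small. -/
theorem exists_norm_scaledPair_sub_lt (q : ℕ) (M ε : ℝ) (hε : 0 < ε) : ∃ δ > 0, ∃ N : ℕ, ∀ n ≥ N,
    ∀ (θhat v : ℕ → EuclideanSpace ℝ (Fin q)) (θ θbar : EuclideanSpace ℝ (Fin q)),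
    ‖(endpointGram (partialSumPath n v)).1‖ ^ 2 +
      ∑ i, (endpointGram (partialSumPath n v)).2 i i < M →
    ‖(√(n : ℝ))⁻¹ • expansionError θhat θbar v n‖ < δ →
    ((n : ℝ) ^ 2)⁻¹ * ∑ t ∈ Finset.Icc 1 n, ‖expansionError θhat θbar v t‖ ^ 2 < δ →
    √(n : ℝ) * ‖θ - θbar‖ < δ →
    ‖scaledPair θhat θ n - endpointGram (partialSumPath n v)‖ < ε := by
  -- with Young's inequality at level `η` the Gram entries differ by at most `η K + 9 (η⁻¹ + 1) δ`,
  -- and both terms are at most `ε / 4`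
  set K : ℝ := max M 1 with hK
  have hK0 : 0 < K := lt_of_lt_of_le one_pos (le_max_right _ _)
  set η : ℝ := ε / (4 * K) with hη
  have hη0 : 0 < η := by positivity
  set L : ℝ := η⁻¹ + 1 with hL
  have hL0 : 0 < L := by positivity
  set δ : ℝ := min 1 (min (ε / 2) (ε / (36 * L))) with hδ
  have hδ0 : 0 < δ := by positivity
  have hδ1 : δ ≤ 1 := min_le_left _ _
  have hδ2 : δ ≤ ε / 2 := (min_le_right _ _).trans (min_le_left _ _)
  have hδ3 : L * δ ≤ ε / 36 := by
    have h := (min_le_right 1 (min (ε / 2) (ε / (36 * L)))).trans (min_le_right _ _)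
    rw [← hδ, le_div_iff₀ (by positivity)] at h
    linarith
  obtain ⟨N, hN⟩ := exists_nat_gt (K / δ)
  refine ⟨δ, hδ0, N, fun n hn θhat v θ θbar hA h1 h2 h3 => ?_⟩
  have hnN : K / δ < n := hN.trans_le (by exact_mod_cast hn)
  have hn0 : (0 : ℝ) < n := lt_trans (by positivity) hnN
  have hn1 : 0 < n := Nat.cast_pos.1 hn0
  have hn1' : (1 : ℝ) ≤ n := by exact_mod_cast hn1
  have hKn : ((n : ℝ) ^ 2)⁻¹ * K ≤ δ := by
    rw [inv_mul_le_iff₀ (by positivity)]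
    rw [div_lt_iff₀ hδ0] at hnN
    have : (n : ℝ) ≤ (n : ℝ) ^ 2 := by nlinarith
    nlinarith
  have hdiag : ∀ i, 0 ≤ (endpointGram (partialSumPath n v)).2 i i :=
    fun i => integral_sq_tiedDown_nonneg _ i
  have hAK := hA.trans_le (le_max_left M 1)
  have hA1 : ‖partialSumPath n v 1‖ ^ 2 ≤ K := by
    have := Finset.sum_nonneg fun i (_ : i ∈ Finset.univ) => hdiag i
    have h : ‖(endpointGram (partialSumPath n v)).1‖ ^ 2 ≤ K := by linarith
    exact h
  have hA2 : ∀ i, (endpointGram (partialSumPath n v)).2 i i ≤ K := fun i => by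
    have := Finset.single_le_sum (fun i _ => hdiag i) (Finset.mem_univ i)
    have := sq_nonneg ‖(endpointGram (partialSumPath n v)).1‖
    linarith
  rw [Prod.norm_def, max_lt_iff]
  constructor
  · have h := norm_scaledPair_fst_sub_le θhat θ θbar v hn1
    refine lt_of_le_of_lt h ?_
    linarith
  · refine lt_of_le_of_lt ((pi_norm_le_iff_of_nonneg (r := 3 / 4 * ε) (by positivity)).2 fun i =>
      (pi_norm_le_iff_of_nonneg (by positivity)).2 fun j => ?_) (by linarith)
    have hG : ∀ i, ∫ r, (estimatePath θhat n i r - tiedDown (partialSumPath n v).toFun i r) ^ 2 ≤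
        9 * δ := fun i => by
      refine (integral_sq_estimatePath_sub_le θhat θbar v hn1 i).trans ?_
      have e1 : ‖(√(n : ℝ))⁻¹ • expansionError θhat θbar v n‖ ^ 2 ≤ δ := by
        have := norm_nonneg ((√(n : ℝ))⁻¹ • expansionError θhat θbar v n)
        nlinarith
      have e2 : ((n : ℝ) ^ 2)⁻¹ * ‖partialSumPath n v 1‖ ^ 2 ≤ δ :=
        (mul_le_mul_of_nonneg_left hA1 (by positivity)).trans hKn
      linarith
    have hmain := abs_integral_mul_sub_le (isCadlag_estimatePath θhat n i)
      (isCadlag_estimatePath θhat n j) ((partialSumPath n v).isCadlag.tiedDown i)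
      ((partialSumPath n v).isCadlag.tiedDown j) hη0
    rw [integral_estimatePath θhat hn1] at hmain
    have b1 : η / 2 * ((endpointGram (partialSumPath n v)).2 i i +
        (endpointGram (partialSumPath n v)).2 j j) ≤ ε / 4 := by
      calc _ ≤ η / 2 * (K + K) :=
            mul_le_mul_of_nonneg_left (add_le_add (hA2 i) (hA2 j)) (by positivity)
        _ = ε / 4 := by rw [hη]; field_simp; ring
    have b2 := mul_le_mul_of_nonneg_left (add_le_add (hG i) (hG j))
      (show 0 ≤ (η⁻¹ + 1) / 2 by positivity)
    rw [← hL] at b2 hmain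
    refine hmain.trans ((add_le_add b1 b2).trans ?_)
    nlinarith

theorem _root_.MeasureTheory.TendstoInMeasure.of_norm_le {ι Ω E : Type*} [MeasurableSpace Ω]
    {μ : Measure Ω} {l : Filter ι} [SeminormedAddCommGroup E] {C : ι → Ω → ℝ} {D : ι → Ω → E}
    (hC : TendstoInMeasure μ C l (fun _ => 0)) (h : ∀ᶠ n in l, ∀ ω, ‖D n ω‖ ≤ C n ω) :
    TendstoInMeasure μ D l (fun _ => 0) := by
  rw [tendstoInMeasure_iff_norm] at hC ⊢
  intro ε hε
  refine tendsto_of_tendsto_of_tendsto_of_le_of_le' tendsto_const_nhds (hC ε hε)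
    (Eventually.of_forall fun _ => zero_le) ?_
  filter_upwards [h] with n hn
  refine measure_mono fun ω hω => ?_
  simp only [Set.mem_ofPred_eq, sub_zero] at hω ⊢
  exact hω.trans ((hn ω).trans (le_abs_self _))

theorem _root_.MeasureTheory.TendstoInMeasure.norm_of_zero {ι Ω E : Type*} [MeasurableSpace Ω]
    {μ : Measure Ω} {l : Filter ι} [SeminormedAddCommGroup E] {D : ι → Ω → E}
    (h : TendstoInMeasure μ D l (fun _ => 0)) :
    TendstoInMeasure μ (fun n ω => ‖D n ω‖) l (fun _ => 0) := by
  rw [tendstoInMeasure_iff_norm] at h ⊢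
  simpa using h

/-- Joint convergence of `√n (θ̂_n - θ)` and `W_n`, from the functional central limit theorem for the
linear terms and the negligibility of the expansion errors. -/
theorem tendstoInDistribution_scaledPair {Ω Ω' : Type*} [MeasurableSpace Ω] {μ : Measure Ω}
    [IsProbabilityMeasure μ] [MeasurableSpace Ω'] {P : Measure Ω'} [IsProbabilityMeasure P]
    {q : ℕ} {θhat : Ω → ℕ → EuclideanSpace ℝ (Fin q)}
    (hθhat : ∀ t, AEMeasurable (fun ω => θhat ω t) μ)
    {θ : EuclideanSpace ℝ (Fin q)} {θbar : ℕ → EuclideanSpace ℝ (Fin q)}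
    {v : ℕ → Ω → ℕ → EuclideanSpace ℝ (Fin q)}
    {Z : Ω' → SkorokhodSpace (EuclideanSpace ℝ (Fin q))}
    (hclt : TendstoInDistribution (fun n ω => partialSumPath n (v n ω)) atTop Z (fun _ => μ) P)
    (hend : TendstoInMeasure μ
      (fun (n : ℕ) ω => ‖(√(n : ℝ))⁻¹ • expansionError (θhat ω) (θbar n) (v n ω) n‖) atTop fun _ => 0)
    (hmean : TendstoInMeasure μ (fun (n : ℕ) ω => ((n : ℝ) ^ 2)⁻¹ *
      ∑ t ∈ Finset.Icc 1 n, ‖expansionError (θhat ω) (θbar n) (v n ω) t‖ ^ 2) atTop fun _ => 0)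
    (hbias : Tendsto (fun n : ℕ => √(n : ℝ) * ‖θ - θbar n‖) atTop (𝓝 0)) :
    TendstoInDistribution (fun n ω => scaledPair (θhat ω) θ n) atTop
      (fun ω' => endpointGram (Z ω')) (fun _ => μ) P := by
  have hclt' := hclt.continuous_comp continuous_endpointGram
  have hcoord : ∀ t i, AEMeasurable (fun ω => θhat ω t i) μ := fun t i =>
    (Measurable.comp_aemeasurable (g := fun x : EuclideanSpace ℝ (Fin q) => x i)
      (by fun_prop) (hθhat t))
  refine tendstoInDistribution_of_tendstoInMeasure_sub _ _ hclt' ?_ fun n => ?_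
  · have hA := hclt'.continuous_comp
      (g := fun p : EuclideanSpace ℝ (Fin q) × (Fin q → Fin q → ℝ) => ‖p.1‖ ^ 2 + ∑ i, p.2 i i)
      (by fun_prop)
    refine tendstoInMeasure_zero_of_bounded hA (hend.add_of_zero hmean) fun M ε hε => ?_
    obtain ⟨δ, hδ, N, hN⟩ := exists_norm_scaledPair_sub_lt q M ε hε
    refine ⟨δ, hδ, ?_⟩
    filter_upwards [eventually_ge_atTop N, hbias.eventually (gt_mem_nhds hδ)] with n hn hb ω hAω hCω
    have hC := (abs_lt.1 hCω).2
    have p1 := norm_nonneg ((√(n : ℝ))⁻¹ • expansionError (θhat ω) (θbar n) (v n ω) n)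
    have p2 : 0 ≤ ((n : ℝ) ^ 2)⁻¹ *
      ∑ t ∈ Finset.Icc 1 n, ‖expansionError (θhat ω) (θbar n) (v n ω) t‖ ^ 2 :=
      mul_nonneg (inv_nonneg.2 (sq_nonneg _)) (Finset.sum_nonneg fun _ _ => sq_nonneg _)
    have hAω' : ‖(endpointGram (partialSumPath n (v n ω))).1‖ ^ 2 +
      ∑ i, (endpointGram (partialSumPath n (v n ω))).2 i i < M := hAω
    have h1 : ‖(√(n : ℝ))⁻¹ • expansionError (θhat ω) (θbar n) (v n ω) n‖ < δ :=
      lt_of_le_of_lt (le_add_of_nonneg_right p2) hC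
    have h2 : ((n : ℝ) ^ 2)⁻¹ *
        ∑ t ∈ Finset.Icc 1 n, ‖expansionError (θhat ω) (θbar n) (v n ω) t‖ ^ 2 < δ :=
      lt_of_le_of_lt (le_add_of_nonneg_left p1) hC
    exact hN n hn (θhat ω) (v n ω) θ (θbar n) hAω' h1 h2 hb
  · have hfst : AEMeasurable (fun ω => √(n : ℝ) • (θhat ω n - θ)) μ :=
      ((hθhat n).sub_const θ).const_smul (√(n : ℝ))
    refine hfst.prodMk
      (aemeasurable_pi_lambda _ fun i => aemeasurable_pi_lambda _ fun j => ?_)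
    refine AEMeasurable.const_mul (Finset.aemeasurable_fun_sum _ fun t _ => ?_) _
    exact (((hcoord t i).sub (hcoord n i)).mul ((hcoord t j).sub (hcoord n j))).const_mul _

/-! ### The limit of the self-normalized statistic -/

theorem endpointGram_linearPath {q : ℕ} (Δ : Matrix (Fin q) (Fin q) ℝ) (b : Fin q → C(ℝ≥0, ℝ)) :
    endpointGram (linearPath Δ b) =
      (WithLp.toLp 2 (Δ *ᵥ fun i => b i 1), (Δ * limitV b * Δᵀ : Matrix _ _ ℝ)) := by
  have hone : unitInterval.toNNReal 1 = 1 := by ext; simp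
  refine Prod.ext ?_ ?_
  · simp [endpointGram, linearPath, hone]
  · have htied : ∀ i (r : unitInterval), tiedDown (linearPath Δ b).toFun i r =
        ∑ k, Δ i k * bridge b k r := by
      intro i r
      have hr : unitInterval.toNNReal r = Real.toNNReal r := by
        ext
        rw [Real.coe_toNNReal _ r.2.1]
        rfl
      simp only [tiedDown, linearPath, Matrix.mulVec, dotProduct, bridge, hone, hr, mul_sub,
        Finset.sum_sub_distrib, Finset.mul_sum]
      congr 1
      exact Finset.sum_congr rfl fun k _ => by ring
    have hc := continuous_bridge b
    have hint : ∀ i j k l, Integrable (fun r : unitInterval =>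
        Δ i k * (bridge b k r * bridge b l r) * Δ j l) volume := fun i j k l => by
      refine IsCadlag.integrable (Continuous.isCadlag ?_)
      have := (hc k).comp (continuous_subtype_val (p := (· ∈ unitInterval)))
      have := (hc l).comp (continuous_subtype_val (p := (· ∈ unitInterval)))
      simp only [Function.comp_def] at *
      fun_prop
    ext i j
    simp only [endpointGram, htied, Finset.sum_mul_sum]
    have hre : ∀ r : unitInterval, ∑ k, ∑ l, Δ i k * bridge b k r * (Δ j l * bridge b l r) =
        ∑ k, ∑ l, Δ i k * (bridge b k r * bridge b l r) * Δ j l := fun r =>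
      Finset.sum_congr rfl fun k _ => Finset.sum_congr rfl fun l _ => by ring
    simp only [hre]
    rw [integral_finsetSum _ fun k _ => integrable_finsetSum _ fun l _ => hint i j k l]
    simp only [Matrix.mul_apply, Matrix.transpose_apply, limitV, Matrix.of_apply, Finset.sum_mul]
    symm
    rw [Finset.sum_comm]
    refine Finset.sum_congr rfl fun k _ => ?_
    rw [integral_finsetSum _ fun l _ => hint i j k l]
    refine Finset.sum_congr rfl fun l _ => ?_
    rw [integral_mul_const, integral_const_mul,
      integral_unitInterval fun r => bridge b k r * bridge b l r]

/-- The self-normalized statistic does not depend on the normalizing matrix `Δ`. -/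
theorem quadForm_conj_inv {q : ℕ} {Δ V : Matrix (Fin q) (Fin q) ℝ} (hΔ : IsUnit Δ.det)
    (x : Fin q → ℝ) :
    (Δ *ᵥ x) ⬝ᵥ ((Δ * V * Δᵀ)⁻¹ *ᵥ (Δ *ᵥ x)) = x ⬝ᵥ (V⁻¹ *ᵥ x) := by
  have hT : IsUnit Δᵀ.det := by rwa [Matrix.det_transpose]
  rw [Matrix.mul_inv_rev, Matrix.mul_inv_rev, ← Matrix.mulVec_mulVec, ← Matrix.mulVec_mulVec,
    Matrix.mulVec_mulVec x, Matrix.nonsing_inv_mul _ hΔ, Matrix.one_mulVec,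
    Matrix.dotProduct_mulVec, ← Matrix.vecMul_transpose, Matrix.vecMul_vecMul,
    Matrix.mul_nonsing_inv _ hT, Matrix.vecMul_one]

theorem continuousAt_inv_quadForm {q : ℕ} {p : (Fin q → ℝ) × (Fin q → Fin q → ℝ)}
    (hp : (Matrix.of p.2).det ≠ 0) :
    ContinuousAt (fun p : (Fin q → ℝ) × (Fin q → Fin q → ℝ) =>
      p.1 ⬝ᵥ ((Matrix.of p.2)⁻¹ *ᵥ p.1)) p := by
  have hdet : Continuous fun p : (Fin q → ℝ) × (Fin q → Fin q → ℝ) => (Matrix.of p.2).det :=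
    Continuous.matrix_det continuous_snd
  have hadj : ∀ i j, Continuous fun p : (Fin q → ℝ) × (Fin q → Fin q → ℝ) =>
      (Matrix.of p.2).adjugate i j := fun i j =>
    (Continuous.matrix_adjugate (A := fun p : (Fin q → ℝ) × (Fin q → Fin q → ℝ) =>
      Matrix.of p.2) continuous_snd).matrix_elem i j
  simp only [dotProduct, Matrix.mulVec, Matrix.inv_def, Ring.inverse_eq_inv', Matrix.smul_apply,
    smul_eq_mul]
  have h1 : ∀ i, ContinuousAt (fun p : (Fin q → ℝ) × (Fin q → Fin q → ℝ) => p.1 i) p :=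
    fun i => ((continuous_apply i).comp continuous_fst).continuousAt
  exact tendsto_finsetSum _ fun i _ => (h1 i).mul (tendsto_finsetSum _ fun j _ =>
    ((hdet.continuousAt.inv₀ hp).mul (hadj i j).continuousAt).mul (h1 j))

theorem selfNormStat_eq {q : ℕ} (θhat : ℕ → EuclideanSpace ℝ (Fin q))
    (θ : EuclideanSpace ℝ (Fin q)) (n : ℕ) :
    selfNormStat θhat θ n = (scaledPair θhat θ n).1.ofLp ⬝ᵥ
      ((Matrix.of (scaledPair θhat θ n).2)⁻¹ *ᵥ (scaledPair θhat θ n).1.ofLp) := by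
  have h : (scaledPair θhat θ n).1.ofLp = √(n : ℝ) • fun i => θhat n i - θ i := rfl
  rw [h, Matrix.mulVec_smul, dotProduct_smul, smul_dotProduct, smul_smul,
    Real.mul_self_sqrt (Nat.cast_nonneg n)]
  rfl

/-- An atomless real random variable does not exceed its upper `α`-percentile with probability
exactly `1 - α`. -/
theorem measureReal_le_upperPercentile {Ω' : Type*} [MeasurableSpace Ω'] {P : Measure Ω'}
    [IsProbabilityMeasure P] {U : Ω' → ℝ} (hU : AEMeasurable U P)
    (hatom : ∀ c, P (U ⁻¹' {c}) = 0) {α : ℝ} (h0 : 0 < α) (h1 : α < 1) :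
    P.real {ω | U ω ≤ upperPercentile P U α} = 1 - α := by
  have hprob : IsProbabilityMeasure (P.map U) := Measure.isProbabilityMeasure_map hU
  set F := cdf (P.map U) with hF
  have hFx : ∀ x, P.real {ω | U ω ≤ x} = F x := fun x => by
    rw [hF, cdf_eq_real, measureReal_def, measureReal_def,
      Measure.map_apply_of_aemeasurable hU measurableSet_Iic]
    rfl
  have hup : upperPercentile P U α = sInf {x | 1 - α ≤ F x} := by
    simp only [upperPercentile, hFx]
  rw [hFx, hup]
  set S := {x | 1 - α ≤ F x} with hS
  have hne : S.Nonempty := by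
    obtain ⟨x, hx⟩ := ((tendsto_cdf_atTop (P.map U)).eventually
      (lt_mem_nhds (show 1 - α < 1 by linarith))).exists
    exact ⟨x, le_of_lt hx⟩
  have hbdd : BddBelow S := by
    obtain ⟨x, hx⟩ := ((tendsto_cdf_atBot (P.map U)).eventually
      (gt_mem_nhds (show 0 < 1 - α by linarith))).exists
    refine ⟨x, fun y hy => ?_⟩
    by_contra hlt
    exact absurd (hy.trans (monotone_cdf _ (not_le.1 hlt).le)) (not_le.2 hx)
  have hleft : Function.leftLim F (sInf S) = F (sInf S) := by
    have h := F.measure_singleton (sInf S)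
    rw [hF, measure_cdf, Measure.map_apply_of_aemeasurable hU (measurableSet_singleton _), hatom,
      eq_comm, ENNReal.ofReal_eq_zero, ← hF] at h
    exact le_antisymm (F.mono.leftLim_le le_rfl) (by linarith)
  apply le_antisymm
  · have ht := F.mono.tendsto_leftLim (sInf S)
    rw [hleft] at ht
    refine le_of_tendsto ht ?_
    filter_upwards [self_mem_nhdsWithin] with x hx
    exact le_of_lt (not_le.1 (notMem_of_lt_csInf (s := S) hx hbdd))
  · have ht : Tendsto F (𝓝[>] (sInf S)) (𝓝 (F (sInf S))) :=
      (F.right_continuous (sInf S)).mono_left (nhdsWithin_mono _ Set.Ioi_subset_Ici_self)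
    refine ge_of_tendsto ht ?_
    filter_upwards [self_mem_nhdsWithin] with x hx
    obtain ⟨y, hy, hyx⟩ := exists_lt_of_csInf_lt hne hx
    exact hy.trans (F.mono hyx.le)

theorem ae_det_endpointGram_linearPath_ne_zero {Ω' : Type*} [MeasurableSpace Ω'] {P : Measure Ω'}
    [IsProbabilityMeasure P] {q : ℕ} {W : Fin q → Ω' → C(ℝ≥0, ℝ)} (hW : IsBrownianVector W P)
    {Δ : Matrix (Fin q) (Fin q) ℝ} (hΔ : IsUnit Δ.det) :
    ∀ᵐ ω' ∂P, (Matrix.of (endpointGram (linearPath Δ fun i => W i ω')).2).det ≠ 0 := by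
  filter_upwards [ae_posDef_limitV hW] with ω' hω'
  rw [endpointGram_linearPath]
  show (Δ * limitV (fun i => W i ω') * Δᵀ).det ≠ 0
  rw [Matrix.det_mul, Matrix.det_mul, Matrix.det_transpose]
  exact mul_ne_zero (mul_ne_zero hΔ.ne_zero hω'.det_pos.ne') hΔ.ne_zero

theorem tendsto_measureReal_isUnit_det_normMatrix {Ω Ω' : Type*} [MeasurableSpace Ω] {μ : Measure Ω}
    [IsProbabilityMeasure μ] [MeasurableSpace Ω'] {P : Measure Ω'} [IsProbabilityMeasure P]
    {q : ℕ} {W : Fin q → Ω' → C(ℝ≥0, ℝ)} (hW : IsBrownianVector W P)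
    {θhat : Ω → ℕ → EuclideanSpace ℝ (Fin q)} {θ : EuclideanSpace ℝ (Fin q)}
    {Δ : Matrix (Fin q) (Fin q) ℝ} (hΔ : IsUnit Δ.det)
    (h : TendstoInDistribution (fun n ω => scaledPair (θhat ω) θ n) atTop
      (fun ω' => endpointGram (linearPath Δ fun i => W i ω')) (fun _ => μ) P) :
    Tendsto (fun n => μ.real {ω | IsUnit (normMatrix (θhat ω) n).det}) atTop (𝓝 1) := by
  have hdet := ae_det_endpointGram_linearPath_ne_zero hW hΔ
  let G : Set (EuclideanSpace ℝ (Fin q) × (Fin q → Fin q → ℝ)) :=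
    {p | (Matrix.of p.2).det ≠ 0}
  have hG : IsOpen G := by
    have hc : Continuous fun p : EuclideanSpace ℝ (Fin q) × (Fin q → Fin q → ℝ) =>
      (Matrix.of p.2).det := Continuous.matrix_det continuous_snd
    exact isOpen_ne.preimage hc
  have hfr : P ((fun ω' => endpointGram (linearPath Δ fun i => W i ω')) ⁻¹' frontier G) = 0 := by
    refine measure_mono_null (fun ω' hω' => ?_) (ae_iff.1 hdet)
    rw [Set.mem_preimage, hG.frontier_eq] at hω'
    exact hω'.2
  have hlim := tendsto_measure_preimage h hG.measurableSet hfr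
  have hone : P.real ((fun ω' => endpointGram (linearPath Δ fun i => W i ω')) ⁻¹' G) = 1 := by
    have hmem : (fun ω' => endpointGram (linearPath Δ fun i => W i ω')) ⁻¹' G ∈ ae P := hdet
    rw [measureReal_def, measure_congr (eventuallyEq_univ.2 hmem), measure_univ, ENNReal.toReal_one]
  rw [hone] at hlim
  refine hlim.congr fun n => ?_
  congr 1
  ext ω
  exact isUnit_iff_ne_zero.symm

/-- The continuous mapping theorem applied to `(x, M) ↦ x' M⁻¹ x`, which is discontinuous only at
singular `M`; `Δ` cancels in the limit. -/
theorem tendstoInDistribution_selfNormStat {Ω Ω' : Type*} [MeasurableSpace Ω] {μ : Measure Ω}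
    [IsProbabilityMeasure μ] [MeasurableSpace Ω'] {P : Measure Ω'} [IsProbabilityMeasure P]
    {q : ℕ} {W : Fin q → Ω' → C(ℝ≥0, ℝ)} (hW : IsBrownianVector W P)
    {θhat : Ω → ℕ → EuclideanSpace ℝ (Fin q)} {θ : EuclideanSpace ℝ (Fin q)}
    {Δ : Matrix (Fin q) (Fin q) ℝ} (hΔ : IsUnit Δ.det)
    (h : TendstoInDistribution (fun n ω => scaledPair (θhat ω) θ n) atTop
      (fun ω' => endpointGram (linearPath Δ fun i => W i ω')) (fun _ => μ) P) :
    TendstoInDistribution (fun n ω => selfNormStat (θhat ω) θ n) atTop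
      (fun ω' => limitU (fun i => W i ω')) (fun _ => μ) P := by
  have hdet := ae_det_endpointGram_linearPath_ne_zero hW hΔ
  have hm : Measurable fun p : EuclideanSpace ℝ (Fin q) × (Fin q → Fin q → ℝ) =>
      p.1.ofLp ⬝ᵥ ((Matrix.of p.2)⁻¹ *ᵥ p.1.ofLp) :=
    measurable_inv_quadForm.comp
      (((by fun_prop : Measurable fun x : EuclideanSpace ℝ (Fin q) => x.ofLp).comp
        measurable_fst).prodMk measurable_snd)
  have hcomp := h.comp_of_ae_continuousAt hm (by
    filter_upwards [hdet] with ω' hω'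
    have hof : Continuous fun p : EuclideanSpace ℝ (Fin q) × (Fin q → Fin q → ℝ) =>
      (p.1.ofLp, p.2) := ((PiLp.continuous_ofLp 2 _).comp continuous_fst).prodMk continuous_snd
    exact ContinuousAt.comp (f := fun p : EuclideanSpace ℝ (Fin q) × (Fin q → Fin q → ℝ) =>
      (p.1.ofLp, p.2)) (continuousAt_inv_quadForm hω') hof.continuousAt)
  simp only [← selfNormStat_eq, endpointGram_linearPath] at hcomp
  refine hcomp.congr (fun _ => Eventually.of_forall fun _ => rfl)
    (Eventually.of_forall fun ω' => ?_)
  exact quadForm_conj_inv hΔ _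

end SelfNorm

theorem theorem2
    {Ω : Type*} [MeasurableSpace Ω] (μ : Measure Ω) [IsProbabilityMeasure μ]
    {Ω' : Type*} [MeasurableSpace Ω'] (P : Measure Ω') [IsProbabilityMeasure P]
    (q : ℕ) (hq : 0 < q)
    -- the stationary series `(X_t)`
    (X : ℤ → Ω → ℝ) (hX : ∀ t, Measurable (X t)) (hstat : SelfNorm.IsStationary μ X)
    -- `q` independent Brownian motions
    (W : Fin q → Ω' → C(ℝ≥0, ℝ)) (hW : SelfNorm.IsBrownianVector W P)
    -- the target `θ = T_∞(F_∞)`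
    (Tinf : Measure (ℤ → ℝ) → EuclideanSpace ℝ (Fin q)) (θ : EuclideanSpace ℝ (Fin q))
    (hθ : θ = Tinf (SelfNorm.jointLaw μ X))
    -- the recursive estimates `θ̂_t`, based on `(X_1, …, X_t)`
    (S : (t : ℕ) → Measure (Fin t → ℝ) → EuclideanSpace ℝ (Fin q))
    (θhat : Ω → ℕ → EuclideanSpace ℝ (Fin q))
    (hθhat : θhat = SelfNorm.recursiveEstimate S X)
    (hθhat_meas : ∀ t, AEMeasurable (fun ω => θhat ω t) μ)
    -- the positive integers `B_n` and the approximating quantities `θ̄_n`, functionals of `F_{B_n}`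
    (B : ℕ → ℕ) (hB : ∀ n, 0 < B n)
    (τ : (n : ℕ) → Measure (Fin (B n) → ℝ) → EuclideanSpace ℝ (Fin q))
    (θbar : ℕ → EuclideanSpace ℝ (Fin q))
    (hθbar : ∀ n, θbar n = τ n (SelfNorm.marginalLaw μ X (B n)))
    (hθθbar : (fun n => θ - θbar n) =o[atTop] (fun n : ℕ => (n : ℝ) ^ (-(1 / 2) : ℝ)))
    -- the functionals `T_b` and the approximating statistics `T_{B_n}(ρ_{B_n}^t)`
    (T : (b : ℕ) → Measure (Fin b → ℝ) → EuclideanSpace ℝ (Fin q))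
    (θtil : ℕ → ℕ → Ω → EuclideanSpace ℝ (Fin q))
    (hθtil : ∀ n t ω, θtil n t ω = T (B n)
      (SelfNorm.empiricalMeasure t (fun s => SelfNorm.lagBlock X (B n) s ω)))
    -- the influence functions `IF(·; F_{B_n})` of `T_{B_n}` at `F_{B_n}`
    (IF : (n : ℕ) → (Fin (B n) → ℝ) → EuclideanSpace ℝ (Fin q))
    (hIF : ∀ n, SelfNorm.IsInfluenceFunction (T (B n)) (SelfNorm.marginalLaw μ X (B n)) (IF n))
    (hIF_int : ∀ n t, 1 ≤ t → t ≤ n →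
      Integrable (fun ω => IF n (SelfNorm.lagBlock X (B n) t ω)) μ)
    (hIF_mean : ∀ n t, 1 ≤ t → t ≤ n →
      ∫ ω, IF n (SelfNorm.lagBlock X (B n) t ω) ∂μ = 0)
    -- the expansion, with remainders `R_{tn}`
    (R : ℕ → ℕ → Ω → EuclideanSpace ℝ (Fin q))
    (hexp : ∀ n t, 1 ≤ t → t ≤ n → ∀ ω, θtil n t ω - θbar n =
      (t : ℝ)⁻¹ • ∑ s ∈ Finset.Icc 1 t, IF n (SelfNorm.lagBlock X (B n) s ω) + R n t ω)
    -- the functional central limit theorem in `D([0,1]; ℝ^q)`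
    (Δ : Matrix (Fin q) (Fin q) ℝ) (hΔ : ∀ i j, i < j → Δ i j = 0) (hΔpos : (Δ * Δᵀ).PosDef)
    (hFCLT : TendstoInDistribution
      (fun n ω => SelfNorm.partialSumPath n (fun t => IF n (SelfNorm.lagBlock X (B n) t ω)))
      atTop (fun ω' => SelfNorm.linearPath Δ (fun i => W i ω')) (fun _ => μ) P)
    -- condition (i)
    (hi₁ : SelfNorm.IsLittleOP μ (fun n ω => R n n ω) (fun n => (n : ℝ) ^ (-(1 / 2) : ℝ)))
    (hi₂ : SelfNorm.IsLittleOP μ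
      (fun n ω => ((n : ℝ) ^ 2)⁻¹ * ∑ t ∈ Finset.Icc 1 n, ‖(t : ℝ) • R n t ω‖ ^ 2) (fun _ => 1))
    -- condition (ii)
    (hii₁ : SelfNorm.IsLittleOP μ (fun n ω => θtil n n ω - θhat ω n)
      (fun n => (n : ℝ) ^ (-(1 / 2) : ℝ)))
    (hii₂ : SelfNorm.IsLittleOP μ
      (fun n ω => ((n : ℝ) ^ 2)⁻¹ *
        ∑ t ∈ Finset.Icc 1 n, ‖(t : ℝ) • (θtil n t ω - θhat ω t)‖ ^ 2) (fun _ => 1)) :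
    -- the inverses `V_q⁻¹` and `W_n⁻¹` are genuine (almost surely, with probability tending to 1)
    (∀ᵐ ω' ∂P, IsUnit (SelfNorm.limitV (fun i => W i ω')).det) ∧
    Tendsto (fun n => μ.real {ω | IsUnit (SelfNorm.normMatrix (θhat ω) n).det}) atTop (𝓝 1) ∧
    -- `n (θ̂_n - θ)' W_n⁻¹ (θ̂_n - θ) →_D U_q`
    TendstoInDistribution (fun n ω => SelfNorm.selfNormStat (θhat ω) θ n) atTop
      (fun ω' => SelfNorm.limitU (fun i => W i ω')) (fun _ => μ) P ∧
    -- the confidence region has asymptotic coverage probability `1 - α`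
    (∀ α : ℝ, 0 < α → α < 1 →
      Tendsto (fun n => μ.real {ω | θ ∈ SelfNorm.confidenceRegion (θhat ω)
          (SelfNorm.upperPercentile P (fun ω' => SelfNorm.limitU (fun i => W i ω')) α) n})
        atTop (𝓝 (1 - α))) := by
  have hV := SelfNorm.ae_posDef_limitV hW
  have hΔdet : IsUnit Δ.det := by
    have h := hΔpos.det_pos
    rw [Matrix.det_mul, Matrix.det_transpose] at h
    exact isUnit_iff_ne_zero.2 fun h0 => by simp [h0] at h
  set v : ℕ → Ω → ℕ → EuclideanSpace ℝ (Fin q) := fun n ω t =>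
    IF n (SelfNorm.lagBlock X (B n) t ω) with hv
  have hrpow : ∀ n : ℕ, ((n : ℝ) ^ (-(1 / 2) : ℝ))⁻¹ = √(n : ℝ) := fun n => by
    rw [Real.rpow_neg (Nat.cast_nonneg n), inv_inv, Real.sqrt_eq_rpow]
  -- the expansion errors are `t R_{tn} - t (T_{B_n}(ρ_{B_n}^t) - θ̂_t)`
  have herr : ∀ n t, 1 ≤ t → t ≤ n → ∀ ω, SelfNorm.expansionError (θhat ω) (θbar n) (v n ω) t =
      (t : ℝ) • R n t ω - (t : ℝ) • (θtil n t ω - θhat ω t) := by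
    intro n t ht htn ω
    have h0 : (t : ℝ) ≠ 0 := by positivity
    have h := congrArg (fun x => (t : ℝ) • x) (hexp n t ht htn ω)
    simp only [smul_add, smul_smul, mul_inv_cancel₀ h0, one_smul] at h
    simp only [SelfNorm.expansionError]
    rw [← sub_eq_iff_eq_add'] at h
    rw [← h]
    module
  have hbias : Tendsto (fun n : ℕ => √(n : ℝ) * ‖θ - θbar n‖) atTop (𝓝 0) := by
    have h := hθθbar.norm_left.tendsto_div_nhds_zero
    refine h.congr fun n => ?_
    rw [div_eq_mul_inv, hrpow, mul_comm]
  have hend : TendstoInMeasure μ (fun (n : ℕ) ω =>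
      ‖(√(n : ℝ))⁻¹ • SelfNorm.expansionError (θhat ω) (θbar n) (v n ω) n‖) atTop
      fun _ => 0 := by
    refine TendstoInMeasure.of_norm_le (hi₁.norm_of_zero.add_of_zero hii₁.norm_of_zero) ?_
    filter_upwards [eventually_ge_atTop 1] with n hn ω
    have hs : (√(n : ℝ))⁻¹ * n = √(n : ℝ) := by
      have h0 : √(n : ℝ) ≠ 0 := by positivity
      field_simp
      exact (Real.sq_sqrt (Nat.cast_nonneg n)).symm
    rw [norm_norm, herr n n hn le_rfl, smul_sub, smul_smul, smul_smul, hs, hrpow]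
    exact norm_sub_le _ _
  have hmean : TendstoInMeasure μ (fun (n : ℕ) ω => ((n : ℝ) ^ 2)⁻¹ *
      ∑ t ∈ Finset.Icc 1 n, ‖SelfNorm.expansionError (θhat ω) (θbar n) (v n ω) t‖ ^ 2) atTop
      fun _ => 0 := by
    have hC := (hi₂.add_of_zero hii₂).add_of_zero (hi₂.add_of_zero hii₂)
    refine TendstoInMeasure.of_norm_le hC (Eventually.of_forall fun n ω => ?_)
    simp only [inv_one, one_smul]
    rw [Real.norm_of_nonneg (mul_nonneg (inv_nonneg.2 (sq_nonneg _))
      (Finset.sum_nonneg fun _ _ => sq_nonneg _)), ← mul_add, ← mul_add,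
      ← Finset.sum_add_distrib, ← Finset.sum_add_distrib]
    refine mul_le_mul_of_nonneg_left (Finset.sum_le_sum fun t ht => ?_)
      (inv_nonneg.2 (sq_nonneg _))
    obtain ⟨ht1, htn⟩ := Finset.mem_Icc.1 ht
    rw [herr n t ht1 htn]
    have h := norm_sub_le ((t : ℝ) • R n t ω) ((t : ℝ) • (θtil n t ω - θhat ω t))
    nlinarith [norm_nonneg ((t : ℝ) • R n t ω - (t : ℝ) • (θtil n t ω - θhat ω t)),
      sq_nonneg (‖(t : ℝ) • R n t ω‖ - ‖(t : ℝ) • (θtil n t ω - θhat ω t)‖)]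
  have hpair := SelfNorm.tendstoInDistribution_scaledPair hθhat_meas hFCLT hend hmean hbias
  have hstat := SelfNorm.tendstoInDistribution_selfNormStat hW hΔdet hpair
  refine ⟨?_, SelfNorm.tendsto_measureReal_isUnit_det_normMatrix hW hΔdet hpair, hstat, fun α hα0 hα1 => ?_⟩
  · filter_upwards [hV] with ω' hω'
    exact isUnit_iff_ne_zero.2 hω'.det_pos.ne'
  · have hatom : ∀ c, P ((fun ω' => SelfNorm.limitU fun i => W i ω') ⁻¹' {c}) = 0 := fun c =>
      measure_eq_zero_iff_ae_notMem.2 (SelfNorm.ae_limitU_ne ⟨0, hq⟩ hW c)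
    have hlim := SelfNorm.tendsto_measure_preimage hstat (measurableSet_Iic
      (a := SelfNorm.upperPercentile P (fun ω' => SelfNorm.limitU fun i => W i ω') α))
      (by rw [frontier_Iic]; exact hatom _)
    have hα := SelfNorm.measureReal_le_upperPercentile hstat.aemeasurable_limit hatom hα0 hα1
    rw [← hα]
    exact hlim
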